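/- Let $d$ be a natural number, $I_d=\{1,\dots,d\}$, $\mathbb{R}_+=[0,\infty)$, and let $V=\{V_{t}\}_{t\in\mathbb{R}_+^d}$ be a strongly continuous semigroup of isometries on a complex Hilbert space $\mathcal{H}$ (so $V_0=1$ and $V_{s+t}=V_sV_t$). Put $V^{(i)}_s=V_{se_i}$, where $e_1,\dots,e_d$ is the standard basis. Assume that $V$ is doubly commuting, i.e. $V^{(i)}_sV^{(j)*}_t=V^{(j)*}_tV^{(i)}_s$ for all $i\neq j$ and $s,t\ge 0$. For $\beta\subset I_d$ let $V_\beta$ be the representation $V_\beta(t)=\prod_{i\in\beta}V^{(i)}_{t_i}$ of $\mathbb{R}_+^\beta$, and write $\beta^c=I_d\setminus\beta$. A representation is called strongly pure if the adjoints of each of its coordinate semigroups tend to $0$ in the strong operator topology as the parameter tends to $\infty$. A closed subspace is called reducing if it is invariant under all $V_t$ and all $V_t^*$. (a) There is exactly one family $\{\mathcal{H}_\alpha:\alpha\subset I_d\}$ of ($2^d$, pairwise orthogonal, possibly zero) reducing subspaces such that $\mathcal{H}=\bigoplus_{\alpha\subset I_d}\mathcal{H}_\alpha$ and, for every $\alpha\subset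 I_d$, the representation $V_\alpha|_{\mathcal{H}_\alpha}$ is strongly pure and doubly commuting and the representation $V_{\alpha^c}|_{\mathcal{H}_\alpha}$ is unitary. (b) Suppose that $\mathcal{H}$ is separable. Then, for every $\alpha\subset I_d$, there are a separable Hilbert space $\mathcal{K}_\alpha$ and a strongly continuous unitary representation $W_{\alpha^c}$ of $\mathbb{R}_+^{\alpha^c}$ on $\mathcal{K}_\alpha$ such that the restriction of $V=(V_\alpha,V_{\alpha^c})$ to $\mathcal{H}_\alpha$ is unitarily equivalent to $(S\otimes 1_{\mathcal{K}_\alpha},\,1\otimes W_{\alpha^c})$ on $L^2(\mathbb{R}_+^\alpha)\otimes\mathcal{K}_\alpha$. Here $S$ is the shift semigroup of $\mathbb{R}_+^\alpha$ on $L^2(\mathbb{R}_+^\alpha)$: $(S_tf)(x)=f(x-t)$ if $x-t\in\mathbb{R}_+^\alpha$, and $(S_tf)(x)=0$ otherwise. (c) Suppose that $V$ is irreducible, i.e. $\mathcal{H}\neq 0$ and $V$ has no reducing subspaces other than $0$ and $\mathcal{H}$. Then there is exactly one $\alpha\subset I_d$ with $\mathcal{H}_\alpha\neq 0$. For this $\alpha$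 and any Hilbert space $\mathcal{K}_\alpha$ and strongly continuous unitary representation $W_{\alpha^c}$ as in (b), $\mathcal{K}_\alpha$ is one-dimensional and there is a character $\chi$ of $\mathbb{R}^{\alpha^c}$ (a continuous homomorphism into the circle group) such that $W_{\alpha^c}(s)=\chi(s)\,1$ for all $s\in\mathbb{R}_+^{\alpha^c}$. -/

import Mathlib

open MeasureTheory Filter Topology
open scoped NNReal ENNReal TensorProduct InnerProductSpace

universe u

noncomputable section

/-! ### Isometric representations of `ℝ₊^ι` -/

/-- A strongly continuous semigroup of isometries `V = {V t}`, indexed by `t ∈ ℝ₊^ι`,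
on the inner product space `H`. -/
structure IsomRep (ι : Type*) (H : Type*) [NormedAddCommGroup H] [InnerProductSpace ℂ H] where
  /-- the operator `V t` -/
  toFun : (ι → ℝ≥0) → (H →L[ℂ] H)
  map_zero' : toFun 0 = 1
  map_add' : ∀ s t, toFun (s + t) = toFun s * toFun t
  isometry' : ∀ t x, ‖toFun t x‖ = ‖x‖
  continuous' : ∀ x, Continuous fun t => toFun t x

namespace IsomRep

variable {ι : Type*} {H : Type*} [NormedAddCommGroup H] [InnerProductSpace ℂ H]

instance : CoeFun (IsomRep ι H) (fun _ => (ι → ℝ≥0) → (H →L[ℂ] H)) := ⟨toFun⟩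

/-- The one-parameter semigroup `V⁽ⁱ⁾ₜ = V (t eᵢ)`. -/
def coord [DecidableEq ι] (V : IsomRep ι H) (i : ι) (t : ℝ≥0) : H →L[ℂ] H :=
  V (Pi.single i t)

/-- `V⁽ⁱ⁾ₛ` commutes with the adjoint of `V⁽ʲ⁾ₜ` for all `i ≠ j` and all `s, t ≥ 0`. -/
def IsDoublyCommuting [DecidableEq ι] [CompleteSpace H] (V : IsomRep ι H) : Prop :=
  ∀ i j, i ≠ j → ∀ s t : ℝ≥0,
    V.coord i s * ContinuousLinearMap.adjoint (V.coord j t) =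
      ContinuousLinearMap.adjoint (V.coord j t) * V.coord i s

/-- For every `i`, the adjoints of `V⁽ⁱ⁾ₜ` tend to `0` strongly as `t → ∞`. -/
def IsStronglyPure [DecidableEq ι] [CompleteSpace H] (V : IsomRep ι H) : Prop :=
  ∀ i, ∀ x : H, Tendsto (fun t : ℝ≥0 => ContinuousLinearMap.adjoint (V.coord i t) x) atTop (𝓝 0)

/-- Every `V t` is a unitary operator. -/
def IsUnitary [CompleteSpace H] (V : IsomRep ι H) : Prop :=
  ∀ t, V t ∈ unitary (H →L[ℂ] H)

/-- Extension by zero, `ℝ₊^β → ℝ₊^ι`, for a set of coordinates `β`. -/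
def extendZero [DecidableEq ι] (β : Finset ι) (t : β → ℝ≥0) : ι → ℝ≥0 :=
  fun i => if h : i ∈ β then t ⟨i, h⟩ else 0

theorem extendZero_zero [DecidableEq ι] (β : Finset ι) : extendZero β 0 = 0 := by
  funext i; simp [extendZero]

theorem extendZero_add [DecidableEq ι] (β : Finset ι) (s t : β → ℝ≥0) :
    extendZero β (s + t) = extendZero β s + extendZero β t := by
  funext i
  by_cases h : i ∈ β <;> simp [extendZero, h]

theorem continuous_extendZero [DecidableEq ι] (β : Finset ι) :
    Continuous (extendZero β) := by
  refine continuous_pi fun i => ?_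
  by_cases h : i ∈ β
  · simpa [extendZero, h] using continuous_apply (⟨i, h⟩ : β)
  · simpa [extendZero, h] using continuous_const

/-- The representation `V_β` of `ℝ₊^β`, `V_β t = ∏_{i ∈ β} V⁽ⁱ⁾_{t i}`, i.e. the restriction of `V`
to the face `ℝ₊^β ⊆ ℝ₊^ι`. -/
def sub [DecidableEq ι] (V : IsomRep ι H) (β : Finset ι) : IsomRep β H where
  toFun t := V (extendZero β t)
  map_zero' := by rw [extendZero_zero]; exact V.map_zero'
  map_add' s t := by rw [extendZero_add]; exact V.map_add' _ _
  isometry' t x := V.isometry' _ x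
  continuous' x := (V.continuous' x).comp (continuous_extendZero β)

/-- A closed subspace of `H` that is invariant under all `V t` and all their adjoints. -/
structure ReducingSubspace [CompleteSpace H] (V : IsomRep ι H) extends Submodule ℂ H where
  isClosed' : IsClosed (toSubmodule : Set H)
  map_mem' : ∀ t, ∀ x ∈ toSubmodule, V t x ∈ toSubmodule
  adjoint_mem' : ∀ t, ∀ x ∈ toSubmodule, ContinuousLinearMap.adjoint (V t) x ∈ toSubmodule

instance [CompleteSpace H] (V : IsomRep ι H) (M : V.ReducingSubspace) :
    CompleteSpace M.toSubmodule :=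
  M.isClosed'.completeSpace_coe

/-- The restriction of `V` to a reducing subspace. -/
def restrict [CompleteSpace H] (V : IsomRep ι H) (M : V.ReducingSubspace) :
    IsomRep ι M.toSubmodule where
  toFun t := (V t).restrict (M.map_mem' t)
  map_zero' := by
    ext x
    change V 0 (x : H) = x
    rw [V.map_zero']; rfl
  map_add' s t := by
    ext x
    change V (s + t) (x : H) = V s (V t x)
    rw [V.map_add']; rfl
  isometry' t x := V.isometry' t x
  continuous' x := (V.continuous' x).subtype_mk _

/-- `V` is irreducible: `H ≠ 0` and the only reducing subspaces are `0` and `H`. -/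
def IsIrreducible [CompleteSpace H] (V : IsomRep ι H) : Prop :=
  Nontrivial H ∧ ∀ M : V.ReducingSubspace, M.toSubmodule = ⊥ ∨ M.toSubmodule = ⊤

/-- `{M α}`, indexed by the sets of coordinates `α`, is a Wold decomposition of `V`: the
space is the orthogonal direct sum of the reducing subspaces `M α`, and on `M α` the coordinates
in `α` act as a strongly pure doubly commuting representation, those outside `α` unitarily. -/
structure IsWold [Fintype ι] [DecidableEq ι] [CompleteSpace H] (V : IsomRep ι H)
    (M : Finset ι → V.ReducingSubspace) : Prop where
  isHilbertSum : IsHilbertSum ℂ (fun α => (M α).toSubmodule)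
    (fun α => (M α).toSubmodule.subtypeₗᵢ)
  isStronglyPure : ∀ α, ((V.restrict (M α)).sub α).IsStronglyPure
  isDoublyCommuting : ∀ α, ((V.restrict (M α)).sub α).IsDoublyCommuting
  isUnitary : ∀ α, ((V.restrict (M α)).sub αᶜ).IsUnitary

end IsomRep

/-! ### The shift semigroup on `L²(ℝ₊^ι)` -/

/-- Lebesgue measure on the orthant `ℝ₊^ι`, as a measure on `ℝ^ι`. -/
def orthantMeasure (ι : Type*) [Fintype ι] : Measure (ι → ℝ) :=
  volume.restrict {x : ι → ℝ | ∀ i, 0 ≤ x i}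

/-- The Hilbert space `L²(ℝ₊^ι)`. -/
abbrev L2Orthant (ι : Type*) [Fintype ι] : Type _ := Lp ℂ 2 (orthantMeasure ι)

/-- `f(x - t)` if `x - t ∈ ℝ₊^ι`, and `0` otherwise. -/
def shiftFun {ι : Type*} (t : ι → ℝ≥0) (f : (ι → ℝ) → ℂ) : (ι → ℝ) → ℂ :=
  Set.indicator {x : ι → ℝ | ∀ i, 0 ≤ x i - t i} (fun x => f (fun i => x i - t i))

section shift

variable {ι : Type*} [Fintype ι]

theorem measurableSet_shifted (t : ι → ℝ≥0) :
    MeasurableSet {x : ι → ℝ | ∀ i, 0 ≤ x i - t i} := by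
  simp only [Set.ofPred_forall]
  exact MeasurableSet.iInter fun i =>
    measurableSet_le measurable_const ((measurable_pi_apply i).sub_const _)

theorem orthantMeasure_restrict (t : ι → ℝ≥0) :
    (orthantMeasure ι).restrict {x : ι → ℝ | ∀ i, 0 ≤ x i - t i} =
      volume.restrict {x : ι → ℝ | ∀ i, 0 ≤ x i - t i} := by
  rw [orthantMeasure, Measure.restrict_restrict (measurableSet_shifted t)]
  congr 1
  refine Set.inter_eq_left.2 ?_
  intro x hx i
  have h1 : 0 ≤ x i - t i := hx i
  have h2 : (0 : ℝ) ≤ t i := (t i).2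
  linarith

theorem measurePreserving_shift (t : ι → ℝ≥0) :
    MeasurePreserving (fun (x : ι → ℝ) i => x i - t i)
      ((orthantMeasure ι).restrict {x : ι → ℝ | ∀ i, 0 ≤ x i - t i}) (orthantMeasure ι) := by
  rw [orthantMeasure_restrict]
  have h : MeasurePreserving (fun (x : ι → ℝ) i => x i - (t i : ℝ)) volume volume :=
    measurePreserving_sub_right volume (fun i => (t i : ℝ))
  have h0 : MeasurableSet {x : ι → ℝ | ∀ i, 0 ≤ x i} := by
    simpa using measurableSet_shifted (0 : ι → ℝ≥0)
  exact h.restrict_preimage h0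

theorem memLp_shiftFun (t : ι → ℝ≥0) (f : L2Orthant ι) :
    MemLp (shiftFun t f) 2 (orthantMeasure ι) :=
  (memLp_indicator_iff_restrict (measurableSet_shifted t)).2
    ((Lp.memLp f).comp_measurePreserving (measurePreserving_shift t))

theorem shiftFun_congr_ae (t : ι → ℝ≥0) {f g : (ι → ℝ) → ℂ} (h : f =ᵐ[orthantMeasure ι] g) :
    shiftFun t f =ᵐ[orthantMeasure ι] shiftFun t g := by
  have h1 := (measurePreserving_shift t).quasiMeasurePreserving.ae_eq_comp h
  have h2 := (ae_restrict_iff' (measurableSet_shifted t)).1 h1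
  filter_upwards [h2] with x hx
  by_cases hm : x ∈ {x : ι → ℝ | ∀ i, 0 ≤ x i - t i}
  · rw [shiftFun, shiftFun, Set.indicator_of_mem hm, Set.indicator_of_mem hm]
    exact hx hm
  · rw [shiftFun, shiftFun, Set.indicator_of_notMem hm, Set.indicator_of_notMem hm]

/-- The shift operator `S t` on `L²(ℝ₊^ι)`. -/
def shift (t : ι → ℝ≥0) : L2Orthant ι →ₗᵢ[ℂ] L2Orthant ι where
  toFun f := (memLp_shiftFun t f).toLp (shiftFun t f)
  map_add' f g := by
    rw [← MemLp.toLp_add]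
    refine (MemLp.toLp_eq_toLp_iff _ _).2 ?_
    refine (shiftFun_congr_ae t (Lp.coeFn_add f g)).trans (Eventually.of_forall fun x => ?_)
    exact congrFun (Set.indicator_add _ _ _) x
  map_smul' c f := by
    rw [RingHom.id_apply, ← MemLp.toLp_const_smul]
    refine (MemLp.toLp_eq_toLp_iff _ _).2 ?_
    refine (shiftFun_congr_ae t (Lp.coeFn_smul c f)).trans (Eventually.of_forall fun x => ?_)
    exact congrFun (Set.indicator_const_smul _ c _) x
  norm_map' f := by
    change ‖(memLp_shiftFun t f).toLp (shiftFun t f)‖ = ‖f‖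
    rw [Lp.norm_toLp, Lp.norm_def, shiftFun,
      eLpNorm_indicator_eq_eLpNorm_restrict (measurableSet_shifted t)]
    congr 1
    exact eLpNorm_comp_measurePreserving (Lp.aestronglyMeasurable f) (measurePreserving_shift t)

end shift

/-! ### Hilbert space tensor products -/

/-- The Hilbert space tensor product: the completion of the algebraic tensor product with respect
to the inner product `⟪a ⊗ b, c ⊗ d⟫ = ⟪a, c⟫ ⟪b, d⟫`. -/
abbrev HilbertTensor (E F : Type*) [NormedAddCommGroup E] [InnerProductSpace ℂ E]
    [NormedAddCommGroup F] [InnerProductSpace ℂ F] : Type _ :=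
  UniformSpace.Completion (E ⊗[ℂ] F)

/-- The bounded operator `A ⊗ B` on the Hilbert space tensor product. -/
def hilbertTensorMap {E F : Type*} [NormedAddCommGroup E] [InnerProductSpace ℂ E]
    [NormedAddCommGroup F] [InnerProductSpace ℂ F] (A : E →L[ℂ] E) (B : F →L[ℂ] F) :
    HilbertTensor E F →L[ℂ] HilbertTensor E F :=
  (TensorProduct.mapL A B).completion

/-- The restriction of `V = (V_α, V_{αᶜ})` to the reducing subspace `M` is unitarily equivalent to
`(S ⊗ 1, 1 ⊗ W)` on `L²(ℝ₊^α) ⊗ K`. -/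
def IsomRep.EquivShiftTensor {ι : Type*} [Fintype ι] [DecidableEq ι]
    {H K : Type*} [NormedAddCommGroup H] [InnerProductSpace ℂ H] [CompleteSpace H]
    [NormedAddCommGroup K] [InnerProductSpace ℂ K]
    (V : IsomRep ι H) (M : V.ReducingSubspace) (α : Finset ι)
    (W : IsomRep (αᶜ : Finset ι) K) : Prop :=
  ∃ U : HilbertTensor (L2Orthant α) K ≃ₗᵢ[ℂ] M.toSubmodule,
    (∀ (t : α → ℝ≥0) (ξ : HilbertTensor (L2Orthant α) K),
      U (hilbertTensorMap (shift t).toContinuousLinearMap 1 ξ) =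
        (V.restrict M).sub α t (U ξ)) ∧
    (∀ (s : (αᶜ : Finset ι) → ℝ≥0) (ξ : HilbertTensor (L2Orthant α) K),
      U (hilbertTensorMap 1 (W s) ξ) = (V.restrict M).sub αᶜ s (U ξ))

end

-- For one coordinate, `unitaryPart i` is the intersection of the ranges of all `V.coord i t`. Its
-- orthogonal complement consists of the vectors that the adjoints drive to `0`
-- (`mem_unitaryPart_orthogonal`), and double commutation makes both subspaces reducing for the
-- whole of `V`. The projections onto the unitary parts of different coordinates are therefore
-- compatible, and splitting each vector coordinate by coordinate gives the `2^d` summands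
-- (`iSup_woldPart`). In any Wold decomposition the summands are contained in these ones, and a
-- total family allows no strict containment (`IsWold.eq_woldSubspace`).
--
-- The shift model comes from eigenvectors of the adjoints. On `L²(ℝ₊^α)` the function `e^{-|x|}`
-- satisfies `Sₜ* f = e^{-|t|} f`, and its shifts are total. A pure one-parameter semigroup on a
-- nonzero space also has a vector with `Vₜ* k = e⁻ᵗ k`. To see this, let `R` be the Laplace
-- transform at `1`, that is, the resolvent of the generator. The Cayley transform `T = 1 - 2R` is
-- an isometry, and `R + R* - 2RR* = (1 - TT*)/2` maps into the eigenspace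
-- (`adjoint_coord_eigenProj`). If this operator vanished, the norm would be constant along the
-- orbits `Vₜ* R* x`, against purity (`exists_eigenvector`). Induction over the coordinates gives
-- joint eigenvectors, and a complement argument shows that the vectors `V a k`, with `k` in the
-- joint eigenspace, are total.
--
-- The relation `V_b* V_a = V_{(a-b)⁺} V_{(b-a)⁺}*` then forces `⟪V a k, V b k'⟫ = e^{-|a-b|₁} ⟪k,
-- k'⟫`, which is also the Gram matrix of the vectors `Sₐ f ⊗ k` for normalised `f`. Equal Gram
-- matrices of total families give the unitary, and the remaining coordinates act on the joint
-- eigenspace as `W`.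
--
-- In the irreducible case only one summand can be nonzero. If `B` commutes with a unitary `W`, the
-- kernel of `1 ⊗ B` is reducing, so `B B' = 0` forces `B = 0` or `B' = 0`. Applied to the
-- functional calculus of `W s` this makes `W s` scalar. Every operator then commutes with `W`, and
-- a rank-one projection shows that the space is a line.

local postfix:max "†" => ContinuousLinearMap.adjoint

set_option linter.unusedSectionVars false

noncomputable section

/-! ### Adjoints and ranges of a semigroup of isometries -/

namespace IsomRep

variable {ι H : Type*} [NormedAddCommGroup H] [InnerProductSpace ℂ H]

theorem inner_map_map (V : IsomRep ι H) (t : ι → ℝ≥0) (x y : H) :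
    ⟪V t x, V t y⟫_ℂ = ⟪x, y⟫_ℂ :=
  LinearIsometry.inner_map_map ⟨(V t).toLinearMap, V.isometry' t⟩ x y

theorem map_add_apply (V : IsomRep ι H) (s t : ι → ℝ≥0) (x : H) :
    V (s + t) x = V s (V t x) := by
  rw [V.map_add']; rfl

theorem map_comm_apply (V : IsomRep ι H) (s t : ι → ℝ≥0) (x : H) :
    V s (V t x) = V t (V s x) := by
  rw [← map_add_apply, ← map_add_apply, add_comm]

theorem map_zero_apply (V : IsomRep ι H) (x : H) : V 0 x = x := by
  rw [V.map_zero']; rfl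

section Adjoint

variable [CompleteSpace H]

theorem adjoint_map_self (V : IsomRep ι H) (t : ι → ℝ≥0) (x : H) : (V t)† (V t x) = x :=
  ext_inner_right ℂ fun y => by
    rw [ContinuousLinearMap.adjoint_inner_left, V.inner_map_map]

theorem adjoint_add_apply (V : IsomRep ι H) (s t : ι → ℝ≥0) (x : H) :
    (V (s + t))† x = (V s)† ((V t)† x) :=
  ext_inner_right ℂ fun y => by
    simp only [ContinuousLinearMap.adjoint_inner_left, ← map_add_apply, add_comm]

theorem adjoint_zero_apply (V : IsomRep ι H) (x : H) : (V 0)† x = x := by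
  rw [V.map_zero']
  exact ext_inner_right ℂ fun y => by simp [ContinuousLinearMap.adjoint_inner_left]

theorem norm_adjoint_apply_le (V : IsomRep ι H) (t : ι → ℝ≥0) (x : H) : ‖(V t)† x‖ ≤ ‖x‖ := by
  refine ((V t)†.le_opNorm x).trans ?_
  rw [LinearIsometryEquiv.norm_map]
  refine mul_le_of_le_one_left (norm_nonneg _) ?_
  exact (V t).opNorm_le_bound zero_le_one fun y => by rw [one_mul, V.isometry']

theorem mem_range_iff (V : IsomRep ι H) (t : ι → ℝ≥0) (x : H) :
    x ∈ LinearMap.range (V t).toLinearMap ↔ V t ((V t)† x) = x := by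
  constructor
  · rintro ⟨y, rfl⟩
    exact congrArg (V t) (V.adjoint_map_self t y)
  · exact fun h => ⟨_, h⟩

theorem isClosed_range (V : IsomRep ι H) (t : ι → ℝ≥0) :
    IsClosed (LinearMap.range (V t).toLinearMap : Set H) := by
  have : (LinearMap.range (V t).toLinearMap : Set H) = {x | V t ((V t)† x) = x} :=
    Set.ext fun x => V.mem_range_iff t x
  rw [this]
  exact isClosed_eq (by fun_prop) continuous_id

theorem adjoint_restrict_apply (V : IsomRep ι H) (M : V.ReducingSubspace) (t : ι → ℝ≥0)
    (x : M.toSubmodule) : ((((V.restrict M) t)† x : M.toSubmodule) : H) = (V t)† x := by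
  have : ((V.restrict M) t)† x = ⟨(V t)† x, M.adjoint_mem' t x x.2⟩ := by
    refine ext_inner_right ℂ fun y => ?_
    rw [ContinuousLinearMap.adjoint_inner_left, Submodule.coe_inner, Submodule.coe_inner,
      ContinuousLinearMap.adjoint_inner_left]
    rfl
  rw [this]

theorem ReducingSubspace.ext_submodule {V : IsomRep ι H} {M N : V.ReducingSubspace}
    (h : M.toSubmodule = N.toSubmodule) : M = N := by
  cases M; cases N; congr

/-- The orthogonal complement of a subspace invariant under `V` and its adjoints is reducing. -/
def ReducingSubspace.orthogonal (V : IsomRep ι H) (M : Submodule ℂ H)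
    (h : ∀ t, ∀ x ∈ M, V t x ∈ M) (h' : ∀ t, ∀ x ∈ M, (V t)† x ∈ M) : V.ReducingSubspace where
  toSubmodule := Mᗮ
  isClosed' := M.isClosed_orthogonal
  map_mem' t x hx := (Submodule.mem_orthogonal _ _).2 fun u hu => by
    rw [← ContinuousLinearMap.adjoint_inner_left]
    exact (Submodule.mem_orthogonal _ _).1 hx _ (h' t u hu)
  adjoint_mem' t x hx := (Submodule.mem_orthogonal _ _).2 fun u hu => by
    rw [ContinuousLinearMap.adjoint_inner_right]
    exact (Submodule.mem_orthogonal _ _).1 hx _ (h t u hu)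

/-! ### Coordinate semigroups and the Wold decomposition -/

section Coord

variable [DecidableEq ι]

theorem coord_eq (V : IsomRep ι H) (i : ι) (t : ℝ≥0) : V.coord i t = V (Pi.single i t) := rfl

theorem coord_add_apply (V : IsomRep ι H) (i : ι) (s t : ℝ≥0) (x : H) :
    V.coord i (s + t) x = V.coord i s (V.coord i t x) := by
  simp only [coord_eq, Pi.single_add, map_add_apply]

theorem IsDoublyCommuting.coord_adjoint {V : IsomRep ι H} (hV : V.IsDoublyCommuting) {i j : ι}
    (h : i ≠ j) (s t : ℝ≥0) (x : H) :
    V.coord i s ((V.coord j t)† x) = (V.coord j t)† (V.coord i s x) :=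
  DFunLike.congr_fun (hV i j h s t) x

theorem extendZero_single (β : Finset ι) (i : β) (t : ℝ≥0) :
    extendZero β (Pi.single i t) = Pi.single (i : ι) t := by
  funext j
  by_cases h : j ∈ β
  · by_cases hj : j = i
    · subst hj; simp [extendZero]
    · have : (⟨j, h⟩ : β) ≠ i := fun e => hj (congrArg Subtype.val e)
      simp [extendZero, h, Pi.single_eq_of_ne hj, Pi.single_eq_of_ne this]
  · have : j ≠ i := fun e => h (e ▸ i.2)
    simp [extendZero, h, Pi.single_eq_of_ne this]

theorem coord_sub (V : IsomRep ι H) (β : Finset ι) (i : β) (t : ℝ≥0) :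
    (V.sub β).coord i t = V.coord i t :=
  congrArg V.toFun (extendZero_single β i t)

variable [Fintype ι]

/-- A property closed under addition of parameters holds for all parameters if it holds on the
coordinate axes. -/
theorem induction_single {p : (ι → ℝ≥0) → Prop} (h0 : p 0)
    (hadd : ∀ s t, p s → p t → p (s + t)) (t : ι → ℝ≥0) (h : ∀ i, p (Pi.single i (t i))) :
    p t := by
  rw [← Finset.univ_sum_single t]
  exact Finset.sum_induction _ p hadd h0 fun i _ => h i

theorem map_mem_of_coord (V : IsomRep ι H) (M : Submodule ℂ H)
    (h : ∀ i r, ∀ x ∈ M, V.coord i r x ∈ M) (t : ι → ℝ≥0) : ∀ x ∈ M, V t x ∈ M := by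
  refine induction_single (p := fun t => ∀ x ∈ M, V t x ∈ M) ?_ ?_ t fun i => h i (t i)
  · intro x hx; rwa [map_zero_apply]
  · intro s t hs ht x hx; rw [map_add_apply]; exact hs _ (ht x hx)

theorem adjoint_mem_of_coord (V : IsomRep ι H) (M : Submodule ℂ H)
    (h : ∀ i r, ∀ x ∈ M, (V.coord i r)† x ∈ M) (t : ι → ℝ≥0) : ∀ x ∈ M, (V t)† x ∈ M := by
  refine induction_single (p := fun t => ∀ x ∈ M, (V t)† x ∈ M) ?_ ?_ t fun i => h i (t i)
  · intro x hx; rwa [adjoint_zero_apply]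
  · intro s t hs ht x hx; rw [adjoint_add_apply]; exact hs _ (ht x hx)

theorem IsDoublyCommuting.map_adjoint {V : IsomRep ι H} (hV : V.IsDoublyCommuting)
    (s t : ι → ℝ≥0) (h : ∀ i, s i = 0 ∨ t i = 0) (x : H) :
    V s ((V t)† x) = (V t)† (V s x) := by
  refine induction_single (p := fun s => ∀ x, V s ((V t)† x) = (V t)† (V s x)) ?_ ?_ s ?_ x
  · intro x; simp only [map_zero_apply]
  · intro s s' hs hs' x; simp only [map_add_apply, hs, hs']
  intro i x
  refine induction_single
    (p := fun t => ∀ x, V (Pi.single i (s i)) ((V t)† x) = (V t)† (V (Pi.single i (s i)) x))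
    ?_ ?_ t ?_ x
  · intro x; simp only [adjoint_zero_apply]
  · intro t t' ht ht' x; simp only [adjoint_add_apply, ht, ht']
  intro j x
  by_cases hij : i = j
  · subst hij
    rcases h i with h | h
    · simp only [h, Pi.single_zero, map_zero_apply]
    · simp only [h, Pi.single_zero, adjoint_zero_apply]
  · exact hV.coord_adjoint hij _ _ x

/-- The largest subspace on which the `i`-th coordinate semigroup is unitary. -/
def unitaryPart (V : IsomRep ι H) (i : ι) : Submodule ℂ H :=
  ⨅ t : ℝ≥0, LinearMap.range (V.coord i t).toLinearMap

theorem mem_unitaryPart (V : IsomRep ι H) (i : ι) (x : H) :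
    x ∈ V.unitaryPart i ↔ ∀ t, V.coord i t ((V.coord i t)† x) = x := by
  simp only [unitaryPart, Submodule.mem_iInf]
  exact forall_congr' fun t => V.mem_range_iff _ x

theorem isClosed_unitaryPart (V : IsomRep ι H) (i : ι) :
    IsClosed (V.unitaryPart i : Set H) := by
  rw [unitaryPart, Submodule.coe_iInf]
  exact isClosed_iInter fun t => V.isClosed_range _

theorem map_mem_unitaryPart (V : IsomRep ι H)
    (i : ι) (t : ι → ℝ≥0) (x : H) (hx : x ∈ V.unitaryPart i) : V t x ∈ V.unitaryPart i := by
  simp only [unitaryPart, Submodule.mem_iInf] at hx ⊢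
  intro s
  obtain ⟨z, rfl⟩ := hx s
  exact ⟨V t z, V.map_comm_apply _ _ z⟩

/-- Another coordinate's adjoint commutes with `V.coord i s` and so preserves its range. For the
same coordinate, the adjoint strips off part of a longer shift. -/
theorem IsDoublyCommuting.adjoint_mem_unitaryPart {V : IsomRep ι H} (hV : V.IsDoublyCommuting)
    (i : ι) (t : ι → ℝ≥0) (x : H) (hx : x ∈ V.unitaryPart i) :
    (V t)† x ∈ V.unitaryPart i := by
  refine V.adjoint_mem_of_coord _ (fun j r x hx => ?_) t x hx
  simp only [unitaryPart, Submodule.mem_iInf] at hx ⊢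
  intro s
  by_cases hij : i = j
  · subst hij
    -- Membership at the later time `r + s` leaves a factor `V.coord i s` after `r` is cancelled.
    obtain ⟨z, rfl⟩ := hx (r + s)
    refine ⟨z, ?_⟩
    change _ = (V.coord i r)† (V.coord i (r + s) z)
    rw [coord_add_apply, coord_eq V i r, adjoint_map_self]
    rfl
  · obtain ⟨z, rfl⟩ := hx s
    exact ⟨_, hV.coord_adjoint hij s r z⟩

theorem starProjection_range_orthogonal (V : IsomRep ι H) (t : ι → ℝ≥0)
    [(LinearMap.range (V t).toLinearMap)ᗮ.HasOrthogonalProjection] (x : H) :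
    (LinearMap.range (V t).toLinearMap)ᗮ.starProjection x = x - V t ((V t)† x) := by
  refine (Submodule.eq_starProjection_of_mem_of_inner_eq_zero ?_ ?_)
  · refine (Submodule.mem_orthogonal _ _).2 ?_
    rintro _ ⟨y, rfl⟩
    change ⟪V t y, _⟫_ℂ = 0
    rw [inner_sub_right, V.inner_map_map, ContinuousLinearMap.adjoint_inner_right, sub_self]
  · intro w hw
    rw [sub_sub_cancel]
    exact (Submodule.mem_orthogonal _ _).1 hw _ ⟨_, rfl⟩

/-- The ranges decrease in `t`, so the projections `1 - VₜVₜ*` onto their complements increase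
strongly to the projection onto `(V.unitaryPart i)ᗮ`; moreover `‖VₜVₜ* x‖ = ‖Vₜ* x‖`. Conversely,
for `u` in the unitary part, `⟪u, x⟫ = ⟪Vₜ* u, Vₜ* x⟫`, which tends to `0`. -/
theorem mem_unitaryPart_orthogonal (V : IsomRep ι H) (i : ι) (x : H) :
    x ∈ (V.unitaryPart i)ᗮ ↔ Tendsto (fun t : ℝ≥0 => (V.coord i t)† x) atTop (𝓝 0) := by
  constructor
  · intro hx
    let U : ℝ≥0 → Submodule ℂ H := fun t => (LinearMap.range (V.coord i t).toLinearMap)ᗮ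
    have hU : Monotone U := by
      intro s t hst
      refine Submodule.orthogonal_le ?_
      rintro _ ⟨y, rfl⟩
      refine ⟨V.coord i (t - s) y, ?_⟩
      change V.coord i s _ = V.coord i t y
      rw [← coord_add_apply, add_tsub_cancel_of_le hst]
    have hcl : (⨆ t, U t).topologicalClosure = (V.unitaryPart i)ᗮ := by
      rw [← Submodule.orthogonal_orthogonal_eq_closure, ← Submodule.iInf_orthogonal, unitaryPart]
      congr 2
      funext t
      rw [Submodule.orthogonal_orthogonal_eq_closure]
      exact (V.isClosed_range (Pi.single i t)).submodule_topologicalClosure_eq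
    have h1 := Submodule.starProjection_tendsto_closure_iSup U hU x
    rw [Submodule.starProjection_eq_self_iff.2 (hcl ▸ hx)] at h1
    have h2 : Tendsto (fun t : ℝ≥0 => V.coord i t ((V.coord i t)† x)) atTop (𝓝 0) := by
      have h3 := h1.const_sub x
      rw [sub_self] at h3
      refine h3.congr fun t => ?_
      exact (congrArg (x - ·) (V.starProjection_range_orthogonal (Pi.single i t) x)).trans
        (sub_sub_cancel _ _)
    rw [tendsto_zero_iff_norm_tendsto_zero] at h2 ⊢
    exact h2.congr fun t => V.isometry' _ _
  · intro hx
    refine (Submodule.mem_orthogonal _ _).2 fun u hu => ?_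
    rw [mem_unitaryPart] at hu
    have h1 : Tendsto (fun t : ℝ≥0 => ‖u‖ * ‖(V.coord i t)† x‖) atTop (𝓝 0) := by
      simpa using hx.norm.const_mul ‖u‖
    have h2 : ‖⟪u, x⟫_ℂ‖ ≤ 0 := by
      refine ge_of_tendsto' h1 fun t => ?_
      rw [← hu t, ← ContinuousLinearMap.adjoint_inner_right, hu t]
      calc _ ≤ ‖(V.coord i t)† u‖ * ‖(V.coord i t)† x‖ := norm_inner_le_norm _ _
        _ ≤ _ := by gcongr; exact V.norm_adjoint_apply_le _ _
    exact norm_le_zero_iff.1 h2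

/-- The intersection of the pure parts of the coordinates in `α ∩ s` and the unitary parts of the
coordinates in `s \ α`. -/
def woldPart (V : IsomRep ι H) (s α : Finset ι) : Submodule ℂ H :=
  ⨅ i ∈ s, if i ∈ α then (V.unitaryPart i)ᗮ else V.unitaryPart i

theorem mem_woldPart (V : IsomRep ι H) (s α : Finset ι) (x : H) :
    x ∈ V.woldPart s α ↔
      ∀ i ∈ s, (i ∈ α → x ∈ (V.unitaryPart i)ᗮ) ∧ (i ∉ α → x ∈ V.unitaryPart i) := by
  simp only [woldPart, Submodule.mem_iInf]
  refine forall₂_congr fun i _ => ?_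
  by_cases h : i ∈ α <;> simp [h]

/-- The `α`-summand of the Wold decomposition. -/
def woldSubspace (V : IsomRep ι H) (hV : V.IsDoublyCommuting) (α : Finset ι) :
    V.ReducingSubspace where
  toSubmodule := V.woldPart Finset.univ α
  isClosed' := by
    simp only [woldPart, Submodule.coe_iInf]
    refine isClosed_biInter fun i _ => ?_
    split_ifs
    exacts [Submodule.isClosed_orthogonal _, V.isClosed_unitaryPart i]
  map_mem' t x hx := by
    rw [mem_woldPart] at hx ⊢
    exact fun i hi => ⟨fun h => (ReducingSubspace.orthogonal V _ (V.map_mem_unitaryPart i)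
      (hV.adjoint_mem_unitaryPart i)).map_mem' t x ((hx i hi).1 h),
      fun h => V.map_mem_unitaryPart i t x ((hx i hi).2 h)⟩
  adjoint_mem' t x hx := by
    rw [mem_woldPart] at hx ⊢
    exact fun i hi => ⟨fun h => (ReducingSubspace.orthogonal V _ (V.map_mem_unitaryPart i)
      (hV.adjoint_mem_unitaryPart i)).adjoint_mem' t x ((hx i hi).1 h),
      fun h => hV.adjoint_mem_unitaryPart i t x ((hx i hi).2 h)⟩

theorem mem_woldSubspace {V : IsomRep ι H} (hV : V.IsDoublyCommuting) (α : Finset ι) (x : H) :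
    x ∈ (V.woldSubspace hV α).toSubmodule ↔
      ∀ i, (i ∈ α → x ∈ (V.unitaryPart i)ᗮ) ∧ (i ∉ α → x ∈ V.unitaryPart i) := by
  simp [woldSubspace, mem_woldPart]

theorem woldSubspace_inner_eq_zero {V : IsomRep ι H} (hV : V.IsDoublyCommuting) {α β : Finset ι}
    (h : α ≠ β) {x y : H} (hx : x ∈ (V.woldSubspace hV α).toSubmodule)
    (hy : y ∈ (V.woldSubspace hV β).toSubmodule) : ⟪x, y⟫_ℂ = 0 := by
  rw [mem_woldSubspace] at hx hy
  obtain ⟨i, hi⟩ : ∃ i, ¬(i ∈ α ↔ i ∈ β) := by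
    by_contra! hc
    exact h (Finset.ext hc)
  by_cases hα : i ∈ α
  · exact Submodule.inner_left_of_mem_orthogonal ((hy i).2 fun hβ => hi ⟨fun _ => hβ, fun _ => hα⟩)
      ((hx i).1 hα)
  · have hβ : i ∈ β := by tauto
    exact Submodule.inner_right_of_mem_orthogonal ((hx i).2 hα) ((hy i).1 hβ)

/-- The projection to `unitaryPart j` preserves `unitaryPart i`. -/
theorem starProjection_mem_unitaryPart {V : IsomRep ι H} (hV : V.IsDoublyCommuting) (i j : ι)
    [(V.unitaryPart j).HasOrthogonalProjection] {x : H} (hx : x ∈ V.unitaryPart i) :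
    (V.unitaryPart j).starProjection x ∈ V.unitaryPart i := by
  -- The projection onto a reducing subspace commutes with every `V t`, and hence preserves ranges.
  have key : ∀ t, ∀ y, V t ((V.unitaryPart j).starProjection y) =
      (V.unitaryPart j).starProjection (V t y) := by
    intro t y
    refine (Submodule.eq_starProjection_of_mem_of_inner_eq_zero
      (V.map_mem_unitaryPart j t _ (Submodule.starProjection_apply_mem _ _)) fun w hw => ?_).symm
    rw [← map_sub, ← ContinuousLinearMap.adjoint_inner_right]
    exact Submodule.inner_left_of_mem_orthogonal (hV.adjoint_mem_unitaryPart j t w hw)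
      (Submodule.sub_starProjection_mem_orthogonal y)
  simp only [unitaryPart, Submodule.mem_iInf] at hx ⊢
  intro s
  obtain ⟨z, hz⟩ := hx s
  refine ⟨(V.unitaryPart j).starProjection z, (key _ z).trans ?_⟩
  rw [← hz]
  rfl

/-- Induction on the coordinates: each new coordinate splits a vector into its unitary and pure
components, and this projection respects the conditions already imposed. -/
theorem iSup_woldPart {V : IsomRep ι H} (hV : V.IsDoublyCommuting) (s : Finset ι) :
    ⨆ α, V.woldPart s α = ⊤ := by
  induction s using Finset.induction_on with
  | empty => exact eq_top_iff.2 (le_iSup_of_le ∅ (by simp [woldPart]))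
  | insert j s hj ih =>
    rw [eq_top_iff, ← ih]
    refine iSup_le fun α x hx => ?_
    have : CompleteSpace (V.unitaryPart j) := (V.isClosed_unitaryPart j).completeSpace_coe
    -- `α` runs over all sets of coordinates, so `j` may or may not lie in it. The unitary component
    -- goes to `α.erase j`, the pure one to `insert j α`.
    rw [← add_sub_cancel ((V.unitaryPart j).starProjection x) x]
    rw [mem_woldPart] at hx
    have hpure : ∀ i, x ∈ (V.unitaryPart i)ᗮ →
        (V.unitaryPart j).starProjection x ∈ (V.unitaryPart i)ᗮ := by
      intro i hi
      refine (Submodule.mem_orthogonal _ _).2 fun u hu => ?_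
      rw [← Submodule.inner_starProjection_left_eq_right]
      exact (Submodule.mem_orthogonal _ _).1 hi _ (starProjection_mem_unitaryPart hV i j hu)
    refine Submodule.add_mem _ ?_ ?_
    · refine Submodule.mem_iSup_of_mem (α.erase j) ((mem_woldPart _ _ _ _).2 fun i hi => ?_)
      rcases Finset.mem_insert.1 hi with rfl | hi
      · exact ⟨fun h => (Finset.notMem_erase _ _ h).elim,
          fun _ => Submodule.starProjection_apply_mem _ _⟩
      · have hij : i ≠ j := fun e => hj (e ▸ hi)
        refine ⟨fun h => hpure i ((hx i hi).1 (Finset.mem_of_mem_erase h)), fun h => ?_⟩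
        exact starProjection_mem_unitaryPart hV i j
          ((hx i hi).2 fun h' => h (Finset.mem_erase.2 ⟨hij, h'⟩))
    · refine Submodule.mem_iSup_of_mem (insert j α) ((mem_woldPart _ _ _ _).2 fun i hi => ?_)
      rcases Finset.mem_insert.1 hi with rfl | hi
      · exact ⟨fun _ => Submodule.sub_starProjection_mem_orthogonal x,
          fun h => (h (Finset.mem_insert_self _ _)).elim⟩
      · have hij : i ≠ j := fun e => hj (e ▸ hi)
        refine ⟨fun h => ?_, fun h => ?_⟩
        · have h1 := (hx i hi).1 (Finset.mem_of_mem_insert_of_ne h hij)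
          exact Submodule.sub_mem _ h1 (hpure i h1)
        · have h1 := (hx i hi).2 fun h' => h (Finset.mem_insert_of_mem h')
          exact Submodule.sub_mem _ h1 (starProjection_mem_unitaryPart hV i j h1)

theorem coe_adjoint_coord_restrict_sub (V : IsomRep ι H) (M : V.ReducingSubspace) (α : Finset ι)
    (i : α) (t : ℝ≥0) (x : M.toSubmodule) :
    (((((V.restrict M).sub α).coord i t)† x : M.toSubmodule) : H) = (V.coord i t)† x := by
  rw [coord_sub]
  exact V.adjoint_restrict_apply M _ x

theorem IsDoublyCommuting.restrict {V : IsomRep ι H} (hV : V.IsDoublyCommuting)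
    (M : V.ReducingSubspace) : (V.restrict M).IsDoublyCommuting := by
  intro i j hij s t
  ext x
  simp only [mul_apply_eq_comp, coord_eq]
  rw [adjoint_restrict_apply]
  change V.coord i s (((V.restrict M) (Pi.single j t))† x : M.toSubmodule) = _
  rw [adjoint_restrict_apply]
  exact hV.coord_adjoint hij s t x

theorem IsDoublyCommuting.sub {V : IsomRep ι H} (hV : V.IsDoublyCommuting)
    (α : Finset ι) : (V.sub α).IsDoublyCommuting := by
  intro i j hij s t
  rw [coord_sub, coord_sub]
  exact hV i j (fun h => hij (Subtype.ext h)) s t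

theorem mem_unitary_iff (V : IsomRep ι H) (t : ι → ℝ≥0) :
    V t ∈ unitary (H →L[ℂ] H) ↔ ∀ x, V t ((V t)† x) = x := by
  rw [Unitary.mem_iff]
  refine ⟨fun h x => DFunLike.congr_fun h.2 x, fun h => ⟨?_, ContinuousLinearMap.ext h⟩⟩
  exact ContinuousLinearMap.ext fun x => V.adjoint_map_self t x

theorem isUnitary_iff (V : IsomRep ι H) :
    V.IsUnitary ↔ ∀ i, V.unitaryPart i = ⊤ := by
  constructor
  · intro h i
    refine eq_top_iff.2 fun x _ => (mem_unitaryPart _ _ _).2 fun t => (V.mem_unitary_iff _).1 (h _) x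
  · intro h t
    rw [mem_unitary_iff]
    refine induction_single (p := fun t => ∀ x, V t ((V t)† x) = x) ?_ ?_ t fun i x => ?_
    · intro x; rw [adjoint_zero_apply, map_zero_apply]
    · intro s t hs ht x
      rw [add_comm s t, map_add_apply, add_comm t s, adjoint_add_apply, hs, ht]
    · exact (mem_unitaryPart V i x).1 (h i ▸ Submodule.mem_top) (t i)

theorem mem_unitaryPart_restrict_sub (V : IsomRep ι H) (M : V.ReducingSubspace) (β : Finset ι)
    (i : β) (x : M.toSubmodule) :
    x ∈ ((V.restrict M).sub β).unitaryPart i ↔ (x : H) ∈ V.unitaryPart i := by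
  rw [mem_unitaryPart, mem_unitaryPart]
  refine forall_congr' fun t => ?_
  rw [← V.coe_adjoint_coord_restrict_sub M β i t x, coord_sub]
  exact Subtype.ext_iff

theorem isWold_woldSubspace {V : IsomRep ι H} (hV : V.IsDoublyCommuting) :
    V.IsWold (V.woldSubspace hV) where
  isHilbertSum := by
    refine IsHilbertSum.mkInternal (F := fun α => (V.woldSubspace hV α).toSubmodule) ?_ ?_
    · intro α β h x y
      exact woldSubspace_inner_eq_zero hV h x.2 y.2
    · have : ⨆ α, (V.woldSubspace hV α).toSubmodule = ⊤ := iSup_woldPart hV Finset.univ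
      rw [this]
      exact Submodule.le_topologicalClosure _
  isStronglyPure α i x := by
    rw [tendsto_subtype_rng]
    refine Tendsto.congr (fun t => (V.coe_adjoint_coord_restrict_sub _ α i t x).symm) ?_
    exact (V.mem_unitaryPart_orthogonal i x).1 (((mem_woldSubspace hV α x).1 x.2 i).1 i.2)
  isDoublyCommuting α := (hV.restrict _).sub α
  isUnitary α := by
    rw [isUnitary_iff]
    refine fun i => eq_top_iff.2 fun x _ => ?_
    rw [mem_unitaryPart_restrict_sub]
    exact ((mem_woldSubspace hV α x).1 x.2 i).2 (Finset.mem_compl.1 i.2)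

theorem IsWold.topologicalClosure_iSup {V : IsomRep ι H} {M : Finset ι → V.ReducingSubspace}
    (hM : V.IsWold M) : (⨆ α, (M α).toSubmodule).topologicalClosure = ⊤ := by
  have h := hM.isHilbertSum.OrthogonalFamily.range_linearIsometry
  simp only [Submodule.subtypeₗᵢ_toLinearMap, Submodule.range_subtype] at h
  rw [← h]
  exact LinearMap.range_eq_top.2 hM.isHilbertSum.surjective_isometry

/-- Purity and unitarity place each `M α` inside the canonical summand. The part of a canonical
summand orthogonal to `M α` is orthogonal to every other `M β` as well, and the `M β` are total. -/
theorem IsWold.eq_woldSubspace {V : IsomRep ι H} (hV : V.IsDoublyCommuting)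
    {M : Finset ι → V.ReducingSubspace} (hM : V.IsWold M) : M = V.woldSubspace hV := by
  have hle : ∀ α, (M α).toSubmodule ≤ (V.woldSubspace hV α).toSubmodule := by
    intro α x hx
    refine (mem_woldSubspace hV α x).2 fun i => ⟨fun hi => ?_, fun hi => ?_⟩
    · rw [mem_unitaryPart_orthogonal]
      have h := hM.isStronglyPure α ⟨i, hi⟩ ⟨x, hx⟩
      rw [tendsto_subtype_rng] at h
      exact h.congr fun t => V.coe_adjoint_coord_restrict_sub _ α ⟨i, hi⟩ t ⟨x, hx⟩
    · have h := (isUnitary_iff _).1 (hM.isUnitary α) ⟨i, Finset.mem_compl.2 hi⟩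
      exact (V.mem_unitaryPart_restrict_sub (M α) αᶜ ⟨i, Finset.mem_compl.2 hi⟩ ⟨x, hx⟩).1
        (h ▸ Submodule.mem_top)
  funext α
  refine ReducingSubspace.ext_submodule (le_antisymm (hle α) fun x hx => ?_)
  have hz : x - (M α).toSubmodule.starProjection x = 0 := by
    set z := x - (M α).toSubmodule.starProjection x with hzdef
    have hzα : z ∈ (V.woldSubspace hV α).toSubmodule :=
      Submodule.sub_mem _ hx (hle α (Submodule.starProjection_apply_mem _ _))
    have hzo : z ∈ (⨆ β, (M β).toSubmodule)ᗮ := by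
      rw [← Submodule.iInf_orthogonal, Submodule.mem_iInf]
      intro β
      by_cases hβ : β = α
      · rw [hβ]; exact Submodule.sub_starProjection_mem_orthogonal x
      · exact (Submodule.mem_orthogonal _ _).2 fun u hu =>
          woldSubspace_inner_eq_zero hV hβ (hle β hu) hzα
    rw [← Submodule.orthogonal_closure, hM.topologicalClosure_iSup, Submodule.top_orthogonal_eq_bot] at hzo
    exact hzo
  rw [sub_eq_zero.1 hz]
  exact Submodule.starProjection_apply_mem _ _

end Coord

end Adjoint

end IsomRep

namespace IsomRep

variable {ι H : Type*} [NormedAddCommGroup H] [InnerProductSpace ℂ H] [CompleteSpace H]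

/-! ### Eigenvectors of the adjoint of a pure one-parameter semigroup -/

section Eigenvector

variable [DecidableEq ι] (V : IsomRep ι H) (i : ι)

theorem adjoint_coord_add_apply (s t : ℝ≥0) (x : H) :
    (V.coord i (s + t))† x = (V.coord i s)† ((V.coord i t)† x) := by
  simp only [coord_eq, Pi.single_add, adjoint_add_apply]

theorem continuous_coord (x : H) : Continuous fun t => V.coord i t x :=
  (V.continuous' x).comp
    (continuous_const.update i continuous_id : Continuous fun t => Function.update (0 : ι → ℝ≥0) i t)

/-- Expanding the square and using contractivity of the adjoint carries strong continuity from `V`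
over to its adjoints. -/
theorem norm_adjoint_coord_sub_le (h : ℝ≥0) (x : H) :
    ‖(V.coord i h)† x - x‖ ^ 2 ≤ 2 * (‖x‖ * ‖V.coord i h x - x‖) := by
  have h1 := norm_sub_sq (𝕜 := ℂ) ((V.coord i h)† x) x
  rw [ContinuousLinearMap.adjoint_inner_left] at h1
  have h2 : ‖(V.coord i h)† x‖ ^ 2 ≤ ‖x‖ ^ 2 := by
    gcongr; exact V.norm_adjoint_apply_le _ x
  have h3 : RCLike.re ⟪x, x - V.coord i h x⟫_ℂ ≤ ‖x‖ * ‖V.coord i h x - x‖ := by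
    rw [norm_sub_rev]
    exact (RCLike.re_le_norm _).trans (norm_inner_le_norm _ _)
  rw [inner_sub_right, map_sub, inner_self_eq_norm_sq] at h3
  linarith

theorem norm_adjoint_coord_sub_sq_le (s t : ℝ≥0) (x : H) :
    ‖(V.coord i s)† x - (V.coord i t)† x‖ ^ 2 ≤
      2 * (‖x‖ * ‖V.coord i (max s t - min s t) x - x‖) := by
  wlog hst : t ≤ s generalizing s t
  · rw [norm_sub_rev, max_comm, min_comm]
    exact this t s (le_of_not_ge hst)
  rw [max_eq_left hst, min_eq_right hst]
  refine le_trans ?_ (V.norm_adjoint_coord_sub_le i (s - t) x)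
  gcongr
  conv_lhs => rw [← add_tsub_cancel_of_le hst, adjoint_coord_add_apply, ← map_sub]
  exact V.norm_adjoint_apply_le _ _

theorem continuous_adjoint_coord (x : H) : Continuous fun t => (V.coord i t)† x := by
  refine continuous_iff_continuousAt.2 fun t => ?_
  rw [ContinuousAt, tendsto_iff_norm_sub_tendsto_zero]
  have h1 : Tendsto (fun s => 2 * (‖x‖ * ‖V.coord i (max s t - min s t) x - x‖)) (𝓝 t) (𝓝 0) := by
    have h2 : Continuous fun s => 2 * (‖x‖ * ‖V.coord i (max s t - min s t) x - x‖) := by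
      have := (V.continuous_coord i x).comp
        (((continuous_id.max continuous_const).sub (continuous_id.min continuous_const) :
          Continuous fun s : ℝ≥0 => max s t - min s t))
      exact continuous_const.mul (continuous_const.mul (this.sub continuous_const).norm)
    have h3 := h2.tendsto t
    simpa [coord_eq, map_zero_apply] using h3
  have h4 : Tendsto (fun s => ‖(V.coord i s)† x - (V.coord i t)† x‖ ^ 2) (𝓝 t) (𝓝 0) :=
    squeeze_zero (fun s => by positivity) (fun s => V.norm_adjoint_coord_sub_sq_le i s t x) h1
  have h5 := h4.sqrt
  simpa [Real.sqrt_sq] using h5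

/-- The Laplace transform `∫₀^∞ e⁻ˢ V⁽ⁱ⁾ₛ x ds`. -/
def laplace (x : H) : H := ∫ s in Set.Ioi (0 : ℝ), Real.exp (-s) • V.coord i s.toNNReal x

/-- The Laplace transform `∫₀^∞ e⁻ˢ V⁽ⁱ⁾ₛ* x ds` of the adjoint semigroup. -/
def adjointLaplace (x : H) : H :=
  ∫ s in Set.Ioi (0 : ℝ), Real.exp (-s) • (V.coord i s.toNNReal)† x

theorem setIntegral_Ioi_comp_add_right (f : ℝ → H) (t : ℝ) :
    ∫ s in Set.Ioi 0, f (s + t) = ∫ s in Set.Ioi t, f s := by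
  have h := (measurePreserving_add_right (volume : Measure ℝ) t).setIntegral_preimage_emb
    (measurableEmbedding_addRight t) f (Set.Ioi t)
  simpa using h

theorem integrableOn_exp_smul {f : ℝ → H} (hf : Continuous f) (C : ℝ) (hC : ∀ s, ‖f s‖ ≤ C)
    (a : ℝ) : IntegrableOn (fun s => Real.exp (-s) • f s) (Set.Ioi a) := by
  refine Integrable.mono' ((integrableOn_exp_neg_Ioi a).mul_const C) ?_ ?_
  · exact Continuous.aestronglyMeasurable (by fun_prop)
  · refine Eventually.of_forall fun s => ?_
    rw [norm_smul, Real.norm_eq_abs, Real.abs_exp]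
    gcongr
    exact hC s

theorem continuous_coord_toNNReal (x : H) : Continuous fun s : ℝ => V.coord i s.toNNReal x :=
  (V.continuous_coord i x).comp continuous_real_toNNReal

theorem continuous_adjoint_coord_toNNReal (x : H) :
    Continuous fun s : ℝ => (V.coord i s.toNNReal)† x :=
  (V.continuous_adjoint_coord i x).comp continuous_real_toNNReal

theorem integrableOn_laplace (x : H) (a : ℝ) :
    IntegrableOn (fun s => Real.exp (-s) • V.coord i s.toNNReal x) (Set.Ioi a) :=
  integrableOn_exp_smul (V.continuous_coord_toNNReal i x) ‖x‖ (fun _ => (V.isometry' _ x).le) a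

theorem integrableOn_adjointLaplace (x : H) (a : ℝ) :
    IntegrableOn (fun s => Real.exp (-s) • (V.coord i s.toNNReal)† x) (Set.Ioi a) :=
  integrableOn_exp_smul (V.continuous_adjoint_coord_toNNReal i x) ‖x‖
    (fun _ => V.norm_adjoint_apply_le _ x) a

theorem inner_laplace (x z : H) : ⟪x, V.laplace i z⟫_ℂ = ⟪V.adjointLaplace i x, z⟫_ℂ := by
  rw [← inner_conj_symm (V.adjointLaplace i x), laplace, adjointLaplace,
    ← integral_inner (V.integrableOn_laplace i z 0),
    ← integral_inner (V.integrableOn_adjointLaplace i x 0), ← integral_conj]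
  congr 1
  funext s
  rw [inner_conj_symm, ← Complex.coe_smul, ← Complex.coe_smul, inner_smul_left, inner_smul_right,
    ContinuousLinearMap.adjoint_inner_left, Complex.conj_ofReal]

theorem adjointLaplace_adjoint_coord (t : ℝ≥0) (x : H) :
    V.adjointLaplace i ((V.coord i t)† x) = (V.coord i t)† (V.adjointLaplace i x) := by
  rw [adjointLaplace, adjointLaplace,
    ← ContinuousLinearMap.integral_comp_comm _ (V.integrableOn_adjointLaplace i x 0)]
  congr 1
  funext s
  rw [← Complex.coe_smul, ← Complex.coe_smul, map_smul, ← adjoint_coord_add_apply,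
    ← adjoint_coord_add_apply, add_comm]

/-- The orbit `V⁽ⁱ⁾ₜ* y` of `y = ∫₀^∞ e⁻ˢ V⁽ⁱ⁾ₛ* x ds`, extended smoothly to all real `t`. -/
def laplaceOrbit (x : H) (t : ℝ) : H :=
  Real.exp t • (V.adjointLaplace i x -
    ∫ s in (0 : ℝ)..t, Real.exp (-s) • (V.coord i s.toNNReal)† x)

/-- The semigroup law and a translation of the variable turn `Vₜ*` of the Laplace integral into `eᵗ`
times the tail of the integral from `t`. In that form the orbit is visibly differentiable. -/
theorem laplaceOrbit_eq (x : H) {t : ℝ} (ht : 0 ≤ t) :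
    V.laplaceOrbit i x t = (V.coord i t.toNNReal)† (V.adjointLaplace i x) := by
  have h1 : V.adjointLaplace i x -
      ∫ s in (0 : ℝ)..t, Real.exp (-s) • (V.coord i s.toNNReal)† x =
      ∫ s in Set.Ioi t, Real.exp (-s) • (V.coord i s.toNNReal)† x := by
    rw [adjointLaplace, sub_eq_iff_eq_add, add_comm]
    exact (intervalIntegral.integral_interval_add_Ioi (V.integrableOn_adjointLaplace i x 0)
      (V.integrableOn_adjointLaplace i x t)).symm
  rw [laplaceOrbit, h1, adjointLaplace,
    ← ContinuousLinearMap.integral_comp_comm _ (V.integrableOn_adjointLaplace i x 0)]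
  have h2 := setIntegral_Ioi_comp_add_right
    (fun s => Real.exp (-s) • (V.coord i s.toNNReal)† x) t
  rw [← h2, ← integral_smul]
  refine setIntegral_congr_fun measurableSet_Ioi fun s hs => ?_
  have hs' : (0 : ℝ) ≤ s := le_of_lt hs
  change Real.exp t • Real.exp (-(s + t)) • (V.coord i (s + t).toNNReal)† x =
    (V.coord i t.toNNReal)† (Real.exp (-s) • (V.coord i s.toNNReal)† x)
  rw [add_comm s t, Real.toNNReal_add ht hs', adjoint_coord_add_apply, smul_smul, ← Real.exp_add,
    ← Complex.coe_smul, ← Complex.coe_smul, map_smul]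
  congr 3
  ring

theorem hasDerivAt_laplaceOrbit (x : H) (t : ℝ) :
    HasDerivAt (V.laplaceOrbit i x)
      (V.laplaceOrbit i x t - (V.coord i t.toNNReal)† x) t := by
  have hc : Continuous fun s : ℝ => Real.exp (-s) • (V.coord i s.toNNReal)† x :=
    (Real.continuous_exp.comp continuous_neg).smul (V.continuous_adjoint_coord_toNNReal i x)
  have h1 : HasDerivAt (fun t => V.adjointLaplace i x -
      ∫ s in (0 : ℝ)..t, Real.exp (-s) • (V.coord i s.toNNReal)† x)
      (-(Real.exp (-t) • (V.coord i t.toNNReal)† x)) t :=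
    (intervalIntegral.integral_hasDerivAt_right (hc.intervalIntegrable _ _)
      (hc.stronglyMeasurableAtFilter _ _) hc.continuousAt).const_sub _
  refine ((Real.hasDerivAt_exp t).smul h1).congr_deriv ?_
  rw [smul_neg, smul_smul, ← Real.exp_add, add_neg_cancel, Real.exp_zero, one_smul, add_comm,
    ← sub_eq_add_neg]
  rfl

theorem continuous_laplaceOrbit (x : H) : Continuous (V.laplaceOrbit i x) :=
  continuous_iff_continuousAt.2 fun t => (V.hasDerivAt_laplaceOrbit i x t).continuousAt

/-- The (scaled) projection `R + R* - 2 R R*` to the vectors `k` with `V⁽ⁱ⁾ₜ* k = e⁻ᵗ k`. -/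
def eigenProj (x : H) : H :=
  V.adjointLaplace i x + V.laplace i (x - (2 : ℝ) • V.adjointLaplace i x)

/-- Split the Laplace integral at `s = t`: below `t`, `Vₜ* Vₛ = Vₜ₋ₛ*`; above `t`, `Vₜ* Vₛ = Vₛ₋ₜ`.
-/
theorem adjoint_coord_laplace (z : H) {t : ℝ} (ht : 0 ≤ t) :
    Real.exp t • (V.coord i t.toNNReal)† (V.laplace i z) =
      (∫ s in (0 : ℝ)..t, Real.exp s • (V.coord i s.toNNReal)† z) + V.laplace i z := by
  have hint := (V.integrableOn_laplace i z 0)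
  have h0 : (V.coord i t.toNNReal)† (V.laplace i z) =
      ∫ s in Set.Ioi (0 : ℝ), Real.exp (-s) • (V.coord i t.toNNReal)† (V.coord i s.toNNReal z) := by
    rw [laplace, ← ContinuousLinearMap.integral_comp_comm _ hint]
    congr 1
    funext s
    rw [← Complex.coe_smul, ← Complex.coe_smul, map_smul]
  have hint' : ∀ a, IntegrableOn
      (fun s => Real.exp (-s) • (V.coord i t.toNNReal)† (V.coord i s.toNNReal z)) (Set.Ioi a) := by
    intro a
    refine integrableOn_exp_smul
      ((V.coord i t.toNNReal)†.continuous.comp (V.continuous_coord_toNNReal i z)) ‖z‖ (fun s => ?_) a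
    exact (V.norm_adjoint_apply_le _ _).trans (V.isometry' _ z).le
  rw [h0, ← intervalIntegral.integral_interval_add_Ioi (hint' 0) (hint' t), smul_add]
  congr 1
  · have h1 := intervalIntegral.integral_comp_sub_left (a := 0) (b := t)
      (fun s => Real.exp s • (V.coord i s.toNNReal)† z) t
    rw [sub_self, sub_zero] at h1
    rw [← h1, ← intervalIntegral.integral_smul]
    refine intervalIntegral.integral_congr fun s hs => ?_
    rw [Set.uIcc_of_le ht] at hs
    rw [smul_smul, ← Real.exp_add, ← sub_eq_add_neg]
    congr 1
    have h2 : t.toNNReal = (t - s).toNNReal + s.toNNReal := by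
      rw [← Real.toNNReal_add (sub_nonneg.2 hs.2) hs.1, sub_add_cancel]
    rw [h2, adjoint_coord_add_apply]
    congr 1
    exact V.adjoint_map_self _ z
  · have h2 := setIntegral_Ioi_comp_add_right
      (fun s => Real.exp (-s) • (V.coord i t.toNNReal)† (V.coord i s.toNNReal z)) t
    rw [← h2, ← integral_smul, laplace]
    refine setIntegral_congr_fun measurableSet_Ioi fun s hs => ?_
    have hs' : (0 : ℝ) ≤ s := le_of_lt hs
    change Real.exp t • Real.exp (-(s + t)) • _ = _
    rw [smul_smul, ← Real.exp_add, add_comm s t, Real.toNNReal_add ht hs', coord_add_apply]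
    congr 1
    · congr 1; ring
    · exact V.adjoint_map_self _ _

/-- It suffices that `eᵗ Vₜ*` fixes `y + R z`, where `z = x - 2y`. The integral that
`adjoint_coord_laplace` contributes from `R z` is exactly what `y` loses. -/
theorem adjoint_coord_eigenProj (x : H) (t : ℝ≥0) :
    (V.coord i t)† (V.eigenProj i x) = Real.exp (-t) • V.eigenProj i x := by
  set y := V.adjointLaplace i x with hy
  set z := x - (2 : ℝ) • y with hz
  have ht : (0 : ℝ) ≤ t := t.2
  have hc : Continuous fun s : ℝ => Real.exp s • (V.coord i s.toNNReal)† z :=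
    Real.continuous_exp.smul (V.continuous_adjoint_coord_toNNReal i z)
  -- The derivative is `eʳ (2 Vᵣ* y - Vᵣ* x + Vᵣ* z)`, which vanishes by the choice of `z`.
  have key : ∀ r ∈ Set.Icc (0 : ℝ) t, Real.exp r • V.laplaceOrbit i x r +
      ∫ s in (0 : ℝ)..r, Real.exp s • (V.coord i s.toNNReal)† z = y := by
    have hd : ∀ r ∈ Set.Ico (0 : ℝ) t, HasDerivAt (fun r => Real.exp r • V.laplaceOrbit i x r +
        ∫ s in (0 : ℝ)..r, Real.exp s • (V.coord i s.toNNReal)† z) 0 r := by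
      intro r hr
      have h1 := ((Real.hasDerivAt_exp r).smul (V.hasDerivAt_laplaceOrbit i x r)).add
        (intervalIntegral.integral_hasDerivAt_right (hc.intervalIntegrable 0 r)
          (hc.stronglyMeasurableAtFilter _ _) hc.continuousAt)
      refine h1.congr_deriv ?_
      rw [hz, map_sub, V.laplaceOrbit_eq i x hr.1, ← Complex.coe_smul 2, map_smul, Complex.coe_smul,
        two_smul]
      module
    intro r hr
    have h2 := constant_of_has_deriv_right_zero (a := (0 : ℝ)) (b := t)
      (f := fun r => Real.exp r • V.laplaceOrbit i x r +
        ∫ s in (0 : ℝ)..r, Real.exp s • (V.coord i s.toNNReal)† z) ?_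
      (fun r hr => (hd r hr).hasDerivWithinAt) r hr
    · simpa [laplaceOrbit] using h2
    · refine Continuous.continuousOn ?_
      exact (Real.continuous_exp.smul (V.continuous_laplaceOrbit i x)).add
        (intervalIntegral.continuous_primitive (fun a b => hc.intervalIntegrable a b) 0)
  have h3 := key t ⟨ht, le_rfl⟩
  have h4 := V.adjoint_coord_laplace i z ht
  rw [V.laplaceOrbit_eq i x ht] at h3
  rw [Real.toNNReal_coe] at h3 h4
  have h5 : Real.exp t • (V.coord i t)† (V.eigenProj i x) = V.eigenProj i x := by
    rw [eigenProj, map_add, smul_add, h4, ← add_assoc, h3]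
  rw [← h5, smul_smul, ← Real.exp_add, neg_add_cancel, Real.exp_zero, one_smul, h5]

theorem exists_eigenvector [Nontrivial H]
    (hV : ∀ x, Tendsto (fun t => (V.coord i t)† x) atTop (𝓝 0)) :
    ∃ k ≠ 0, ∀ t : ℝ≥0, (V.coord i t)† k = Real.exp (-t) • k := by
  by_contra! hcon
  have h0 : ∀ x, V.eigenProj i x = 0 := by
    intro x
    by_contra hx
    obtain ⟨t, ht⟩ := hcon _ hx
    exact ht (V.adjoint_coord_eigenProj i x t)
  -- When `R + R* - 2RR* = 0`, this is the derivative of `‖Vₜ* y‖²` at `0`; replacing `x` by `Vₜ* x`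
  -- gives it at every `t ≥ 0`.
  have hre : ∀ x, ⟪V.adjointLaplace i x, V.adjointLaplace i x - x⟫_ℂ +
      ⟪V.adjointLaplace i x - x, V.adjointLaplace i x⟫_ℂ = 0 := by
    intro x
    set y := V.adjointLaplace i x with hy
    have h1 : y = -V.laplace i (x - (2 : ℝ) • y) := eq_neg_of_add_eq_zero_left (h0 x)
    have h2 : ⟪x, y⟫_ℂ = -⟪y, x - (2 : ℝ) • y⟫_ℂ := by
      conv_lhs => rw [h1]
      rw [inner_neg_right, inner_laplace]
    rw [inner_sub_right, ← Complex.coe_smul, inner_smul_right] at h2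
    rw [inner_sub_right, inner_sub_left, h2]
    push_cast
    ring
  have hy : ∀ x, V.adjointLaplace i x = 0 := by
    intro x
    have hconst : ∀ t : ℝ≥0, ⟪V.laplaceOrbit i x t, V.laplaceOrbit i x t⟫_ℂ =
        ⟪V.adjointLaplace i x, V.adjointLaplace i x⟫_ℂ := by
      intro t
      have h2 := constant_of_has_deriv_right_zero (a := (0 : ℝ)) (b := t)
        (f := fun r => ⟪V.laplaceOrbit i x r, V.laplaceOrbit i x r⟫_ℂ)
        ((V.continuous_laplaceOrbit i x).inner (V.continuous_laplaceOrbit i x)).continuousOn (fun r hr => ?_) t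
        ⟨t.2, le_rfl⟩
      · simpa only [laplaceOrbit, Real.exp_zero, intervalIntegral.integral_same, sub_zero,
          one_smul] using h2
      · have h3 := (V.hasDerivAt_laplaceOrbit i x r).inner ℂ (V.hasDerivAt_laplaceOrbit i x r)
        rw [V.laplaceOrbit_eq i x hr.1, ← adjointLaplace_adjoint_coord, hre] at h3
        exact h3.hasDerivWithinAt
    have hlim := (hV (V.adjointLaplace i x)).inner (𝕜 := ℂ) (hV (V.adjointLaplace i x))
    rw [inner_zero_left] at hlim
    refine inner_self_eq_zero (𝕜 := ℂ).1
      (tendsto_nhds_unique (tendsto_const_nhds (f := (atTop : Filter ℝ≥0))) (hlim.congr ?_))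
    intro t
    have h4 := hconst t
    rwa [V.laplaceOrbit_eq i x t.coe_nonneg, Real.toNNReal_coe] at h4
  obtain ⟨x, hx⟩ := exists_ne (0 : H)
  refine hx ?_
  -- The orbit of `y = 0` is constant for `t ≥ 0`, while its derivative at `0` is `y - x = -x`. Only
  -- the right derivative is available, since `laplaceOrbit` is the semigroup orbit only there.
  have h5 : HasDerivWithinAt (V.laplaceOrbit i x) 0 (Set.Ici 0) 0 := by
    refine (hasDerivWithinAt_const (0 : ℝ) (Set.Ici 0) (0 : H)).congr (fun t ht => ?_) ?_
    · rw [V.laplaceOrbit_eq i x ht, hy, map_zero]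
    · rw [V.laplaceOrbit_eq i x le_rfl, hy, map_zero]
  have h6 := (uniqueDiffWithinAt_Ici (0 : ℝ)).eq_deriv _ h5
    (V.hasDerivAt_laplaceOrbit i x 0).hasDerivWithinAt
  rw [V.laplaceOrbit_eq i x le_rfl, hy, map_zero, Real.toNNReal_zero, zero_sub, coord_eq,
    Pi.single_zero, adjoint_zero_apply] at h6
  exact neg_eq_zero.1 h6.symm

end Eigenvector

/-! ### Joint eigenvectors and their Gram matrix -/

section Joint

variable [DecidableEq ι]

/-- The vectors `x` with `V⁽ⁱ⁾ₜ* x = e⁻ᵗ x` for all `i ∈ s`. -/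
def coordEigenspace (V : IsomRep ι H) (s : Finset ι) : Submodule ℂ H where
  carrier := {x | ∀ i ∈ s, ∀ t : ℝ≥0, (V.coord i t)† x = Real.exp (-t) • x}
  zero_mem' := by simp
  add_mem' {x y} hx hy i hi t := by rw [map_add, hx i hi, hy i hi, smul_add]
  smul_mem' c x hx i hi t := by rw [map_smul, hx i hi, smul_comm]

theorem isClosed_coordEigenspace (V : IsomRep ι H) (s : Finset ι) :
    IsClosed (V.coordEigenspace s : Set H) := by
  change IsClosed {x | ∀ i ∈ s, ∀ t : ℝ≥0, (V.coord i t)† x = Real.exp (-t) • x}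
  simp only [Set.ofPred_forall]
  exact isClosed_iInter fun i => isClosed_iInter fun _ => isClosed_iInter fun t =>
    isClosed_eq (by fun_prop) (by fun_prop)

variable [Fintype ι]

/-- Coordinates outside `s` reduce to the eigenspace of the coordinates in `s`. -/
def IsDoublyCommuting.coordEigenspaceReducing {V : IsomRep ι H} (hV : V.IsDoublyCommuting)
    (s β : Finset ι) (h : Disjoint s β) : (V.sub β).ReducingSubspace where
  toSubmodule := V.coordEigenspace s
  isClosed' := V.isClosed_coordEigenspace s
  map_mem' := by
    refine (V.sub β).map_mem_of_coord _ fun j r x hx i hi t => ?_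
    have hij : (j : ι) ≠ i := fun e => Finset.disjoint_left.1 h hi (e ▸ j.2)
    rw [coord_sub, ← hV.coord_adjoint hij, hx i hi, ← Complex.coe_smul, map_smul, Complex.coe_smul]
  adjoint_mem' := by
    refine (V.sub β).adjoint_mem_of_coord _ fun j r x hx i hi t => ?_
    rw [coord_sub, coord_eq, coord_eq, ← adjoint_add_apply, add_comm, adjoint_add_apply]
    exact (congrArg _ (hx i hi t)).trans (by rw [← Complex.coe_smul, map_smul, Complex.coe_smul])

/-- The eigenspace already found for `s` is reducing for the next coordinate, whose restriction is
still pure and so has an eigenvector inside it. -/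
theorem IsDoublyCommuting.exists_coordEigenvector [Nontrivial H] {V : IsomRep ι H}
    (hV : V.IsDoublyCommuting) (hp : V.IsStronglyPure) (s : Finset ι) :
    ∃ k ≠ 0, k ∈ V.coordEigenspace s := by
  induction s using Finset.induction_on with
  | empty =>
    obtain ⟨x, hx⟩ := exists_ne (0 : H)
    exact ⟨x, hx, fun i hi => (Finset.notMem_empty i hi).elim⟩
  | insert j s hj ih =>
    obtain ⟨k, hk, hks⟩ := ih
    let E := hV.coordEigenspaceReducing s {j} (Finset.disjoint_singleton_right.2 hj)
    have : Nontrivial E.toSubmodule := ⟨⟨k, hks⟩, 0, fun h => hk (congrArg Subtype.val h)⟩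
    let j' : ({j} : Finset ι) := ⟨j, Finset.mem_singleton_self j⟩
    have hcoe : ∀ (t : ℝ≥0) (x : E.toSubmodule),
        (((((V.sub {j}).restrict E).coord j' t)† x : E.toSubmodule) : H) = (V.coord j t)† x := by
      intro t x
      rw [← coord_sub V {j} j']
      exact (V.sub {j}).adjoint_restrict_apply E _ x
    obtain ⟨e, he, het⟩ := ((V.sub {j}).restrict E).exists_eigenvector j' fun x => by
      rw [tendsto_subtype_rng]
      exact (hp j (x : H)).congr fun t => (hcoe t x).symm
    refine ⟨e, fun h => he (Subtype.ext h), fun i hi t => ?_⟩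
    rcases Finset.mem_insert.1 hi with rfl | hi
    · rw [← hcoe, het t]; rfl
    · exact e.2 i hi t

/-- The joint eigenspace `{x | Vₜ* x = e^{-|t|} x for all t}`. -/
def eigenspace (V : IsomRep ι H) : Submodule ℂ H := V.coordEigenspace Finset.univ

theorem adjoint_eigenvector (V : IsomRep ι H) {k : H} (hk : k ∈ V.eigenspace) (t : ι → ℝ≥0) :
    (V t)† k = Real.exp (-∑ i, (t i : ℝ)) • k := by
  refine induction_single (p := fun t => (V t)† k = Real.exp (-∑ i, (t i : ℝ)) • k) ?_ ?_ t ?_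
  · simp [adjoint_zero_apply]
  · intro s t hs ht
    rw [adjoint_add_apply, ht, ← Complex.coe_smul, map_smul, hs, Complex.coe_smul, smul_smul,
      ← Real.exp_add]
    congr 2
    simp [Finset.sum_add_distrib]
  · intro i
    have h := hk i (Finset.mem_univ i) (t i)
    have h2 : ∑ j, ((Pi.single i (t i) : ι → ℝ≥0) j : ℝ) = t i := by
      rw [Finset.sum_eq_single i] <;> simp +contextual
    rw [h2]
    exact h

/-- Subtraction is truncated. The common part `a ⊓ b` cancels by isometry; `a - b` and `b - a` have
disjoint supports, so double commutation lets them pass each other. -/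
theorem IsDoublyCommuting.adjoint_map {V : IsomRep ι H} (hV : V.IsDoublyCommuting)
    (a b : ι → ℝ≥0) (x : H) : (V b)† (V a x) = V (a - b) ((V (b - a))† x) := by
  have ha : a = a ⊓ b + (a - b) := by
    funext i
    rcases le_total (a i) (b i) with h | h <;> simp [h, tsub_eq_zero_of_le, add_tsub_cancel_of_le]
  have hb : b = (b - a) + a ⊓ b := by
    funext i
    rcases le_total (a i) (b i) with h | h <;> simp [h, tsub_eq_zero_of_le, tsub_add_cancel_of_le]
  have hd : ∀ i, (a - b) i = 0 ∨ (b - a) i = 0 := by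
    intro i
    rcases le_total (a i) (b i) with h | h
    · left; simp [h, tsub_eq_zero_of_le]
    · right; simp [h, tsub_eq_zero_of_le]
  rw [hV.map_adjoint _ _ hd]
  conv_lhs => rw [hb, adjoint_add_apply]
  congr 1
  conv_lhs => rw [ha, map_add_apply, ← ha]
  exact V.adjoint_map_self _ _

/-- By `adjoint_map` only adjoints hit the eigenvectors. The exponent equals `-∑ |a i - b i|`,
written with suprema to match the overlap of two shifted orthants. -/
theorem IsDoublyCommuting.inner_map_eigenvector {V : IsomRep ι H} (hV : V.IsDoublyCommuting)
    {k k' : H} (hk : k ∈ V.eigenspace) (hk' : k' ∈ V.eigenspace) (a b : ι → ℝ≥0) :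
    ⟪V a k, V b k'⟫_ℂ =
      Real.exp (∑ i, ((a i : ℝ) + b i - 2 * (a i ⊔ b i : ℝ≥0))) * ⟪k, k'⟫_ℂ := by
  rw [← ContinuousLinearMap.adjoint_inner_left, hV.adjoint_map,
    ← ContinuousLinearMap.adjoint_inner_right, V.adjoint_eigenvector hk,
    V.adjoint_eigenvector hk', ← Complex.coe_smul, ← Complex.coe_smul, inner_smul_left,
    inner_smul_right, Complex.conj_ofReal, ← mul_assoc, ← Complex.ofReal_mul, ← Real.exp_add,
    ← Finset.sum_neg_distrib, ← Finset.sum_neg_distrib, ← Finset.sum_add_distrib]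
  congr 3
  refine Finset.sum_congr rfl fun i _ => ?_
  rcases le_total (a i) (b i) with h | h
  · simp [h, tsub_eq_zero_of_le, NNReal.coe_sub h]; ring
  · simp [h, tsub_eq_zero_of_le, NNReal.coe_sub h]; ring

theorem IsStronglyPure.restrict {V : IsomRep ι H} (hV : V.IsStronglyPure)
    (M : V.ReducingSubspace) : (V.restrict M).IsStronglyPure := by
  intro i x
  rw [tendsto_subtype_rng]
  exact (hV i (x : H)).congr fun t => (V.adjoint_restrict_apply M _ x).symm

/-- The span is invariant under `V` and its adjoints, so its orthogonal complement is reducing. If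
that were nonzero it would contain a joint eigenvector, which already lies in the span. -/
theorem IsDoublyCommuting.topologicalClosure_span_eigenspace {V : IsomRep ι H}
    (hV : V.IsDoublyCommuting) (hp : V.IsStronglyPure) :
    (Submodule.span ℂ (Set.range fun p : (ι → ℝ≥0) × V.eigenspace =>
      V p.1 p.2)).topologicalClosure = ⊤ := by
  set N := Submodule.span ℂ (Set.range fun p : (ι → ℝ≥0) × V.eigenspace => V p.1 p.2) with hN
  have hmem : ∀ a, ∀ k ∈ V.eigenspace, V a k ∈ N := fun a k hk =>
    Submodule.subset_span ⟨(a, ⟨k, hk⟩), rfl⟩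
  have h1 : ∀ t, N ≤ N.comap (V t).toLinearMap := by
    intro t
    refine Submodule.span_le.2 ?_
    rintro _ ⟨⟨a, k⟩, rfl⟩
    change V t (V a k) ∈ N
    rw [← map_add_apply]
    exact hmem _ _ k.2
  have h2 : ∀ t, N ≤ N.comap ((V t)†).toLinearMap := by
    intro t
    refine Submodule.span_le.2 ?_
    rintro _ ⟨⟨a, k⟩, rfl⟩
    change (V t)† (V a k) ∈ N
    rw [hV.adjoint_map, V.adjoint_eigenvector k.2, ← Complex.coe_smul, map_smul]
    exact Submodule.smul_mem _ _ (hmem _ _ k.2)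
  rw [Submodule.topologicalClosure_eq_top_iff]
  by_contra hne
  let M := ReducingSubspace.orthogonal V N (fun t => h1 t) (fun t => h2 t)
  have : Nontrivial M.toSubmodule := Submodule.nontrivial_iff_ne_bot.2 hne
  obtain ⟨k, hk, hke⟩ := (hV.restrict M).exists_coordEigenvector (hp.restrict M) Finset.univ
  have hk' : (k : H) ∈ V.eigenspace := by
    intro i hi t
    have h3 := congrArg Subtype.val (hke i hi t)
    rwa [coord_eq, adjoint_restrict_apply] at h3
  have h4 := (Submodule.mem_orthogonal _ _).1 k.2 _ (hmem 0 k hk')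
  rw [map_zero_apply, inner_self_eq_zero] at h4
  exact hk (Subtype.ext h4)

end Joint

end IsomRep

/-! ### The vector `e^{-|x|}` in the shift model -/

section ShiftModel

variable {ι : Type*} [Fintype ι]

/-- The function `e^{-|x|}` on `ℝ^ι`. -/
def expFun (ι : Type*) [Fintype ι] (x : ι → ℝ) : ℂ := (Real.exp (-∑ i, x i) : ℝ)

theorem orthantMeasure_eq_pi (ι : Type*) [Fintype ι] :
    orthantMeasure ι = Measure.pi fun _ => (volume : Measure ℝ).restrict (Set.Ici 0) := by
  rw [← Measure.restrict_pi_pi, orthantMeasure, volume_pi]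
  congr 1
  ext x
  simp [Pi.le_def]

theorem memLp_expFun (ι : Type*) [Fintype ι] : MemLp (expFun ι) 2 (orthantMeasure ι) := by
  have hc : Continuous fun x : ι → ℝ => Real.exp (-∑ i, x i) := by fun_prop
  refine MemLp.ofReal (K := ℂ) (f := fun x : ι → ℝ => Real.exp (-∑ i, x i)) ?_
  rw [memLp_two_iff_integrable_sq hc.aestronglyMeasurable, orthantMeasure_eq_pi]
  have h1 : (fun x : ι → ℝ => Real.exp (-∑ i, x i) ^ 2) =
      fun x : ι → ℝ => ∏ i, Real.exp (-2 * x i) := by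
    funext x
    rw [← Real.exp_sum, ← Real.exp_nat_mul, ← Finset.mul_sum]
    congr 1
    push_cast
    ring
  rw [h1]
  refine Integrable.fintype_prod (f := fun _ (x : ℝ) => Real.exp (-2 * x)) fun i => ?_
  have h2 := integrableOn_exp_mul_Ioi (a := -2) (by norm_num) 0
  rwa [IntegrableOn, ← Measure.restrict_congr_set Ioi_ae_eq_Ici.symm] at h2

/-- The function `e^{-|x|}` as an element of `L²(ℝ₊^ι)`. -/
def expLp (ι : Type*) [Fintype ι] : L2Orthant ι := (memLp_expFun ι).toLp (expFun ι)

theorem shift_expLp_coeFn (a : ι → ℝ≥0) :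
    shift a (expLp ι) =ᵐ[orthantMeasure ι] shiftFun a (expFun ι) :=
  (MemLp.coeFn_toLp (memLp_shiftFun a (expLp ι))).trans (shiftFun_congr_ae a (MemLp.coeFn_toLp _))

theorem shiftFun_expFun (a : ι → ℝ≥0) (x : ι → ℝ) :
    shiftFun a (expFun ι) x = Set.indicator (Set.Ici fun i => (a i : ℝ))
      (fun x => ((Real.exp (∑ i, (a i : ℝ)) : ℝ) : ℂ) * expFun ι x) x := by
  have h1 : {x : ι → ℝ | ∀ i, 0 ≤ x i - a i} = Set.Ici fun i => (a i : ℝ) := by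
    ext x
    simp [Pi.le_def]
  rw [shiftFun, h1]
  congr 1
  funext x
  rw [expFun, expFun, ← Complex.ofReal_mul, ← Real.exp_add, Finset.sum_sub_distrib]
  congr 2
  ring

theorem inner_shift_expLp (a b : ι → ℝ≥0) :
    ⟪shift a (expLp ι), shift b (expLp ι)⟫_ℂ =
      Real.exp (∑ i, ((a i : ℝ) + b i - 2 * (a i ⊔ b i : ℝ≥0))) * ⟪expLp ι, expLp ι⟫_ℂ := by
  -- The shifts by `a` and `b` overlap on the orthant at `a ⊔ b`, where their product is a constant
  -- times the square of the shift by `a ⊔ b`.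
  rw [← (shift (a ⊔ b)).inner_map_map (expLp ι) (expLp ι), L2.inner_def, L2.inner_def,
    ← integral_const_mul]
  refine integral_congr_ae ?_
  filter_upwards [shift_expLp_coeFn a, shift_expLp_coeFn b, shift_expLp_coeFn (a ⊔ b)]
    with x ha hb hab
  have hmem : x ∈ (Set.Ici fun i => ((a ⊔ b) i : ℝ)) ↔
      x ∈ (Set.Ici fun i => (a i : ℝ)) ∧ x ∈ Set.Ici fun i => (b i : ℝ) := by
    simp only [Set.mem_Ici, Pi.le_def, ← forall_and]
    refine forall_congr' fun i => ?_
    rw [Pi.sup_apply, NNReal.coe_max, max_le_iff]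
  rw [ha, hb, hab, shiftFun_expFun, shiftFun_expFun, shiftFun_expFun]
  by_cases h : x ∈ Set.Ici fun i => ((a ⊔ b) i : ℝ)
  · rw [Set.indicator_of_mem h, Set.indicator_of_mem (hmem.1 h).1,
      Set.indicator_of_mem (hmem.1 h).2]
    simp only [expFun, ← Complex.ofReal_mul, RCLike.inner_apply, Complex.conj_ofReal,
      ← Real.exp_add]
    congr 2
    simp only [Pi.sup_apply, Finset.sum_sub_distrib, Finset.sum_add_distrib, ← Finset.mul_sum]
    ring
  · rw [Set.indicator_of_notMem h, inner_zero_left, mul_zero]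
    rcases not_and_or.1 (fun h' => h (hmem.2 h')) with h' | h'
    · rw [Set.indicator_of_notMem h', inner_zero_left]
    · rw [Set.indicator_of_notMem h', inner_zero_right]

/-- Upper orthants form a π-system generating the Borel sets. Corners with negative entries reduce
to nonnegative ones because the measure lives on `ℝ₊^ι`. -/
theorem ae_eq_zero_of_setIntegral_Ici {h : (ι → ℝ) → ℂ}
    (hint : Integrable h (orthantMeasure ι))
    (h0 : ∀ a : ι → ℝ≥0, ∫ x in Set.Ici (fun i => (a i : ℝ)), h x ∂(orthantMeasure ι) = 0) :
    h =ᵐ[orthantMeasure ι] 0 := by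
  have hac : orthantMeasure ι ≪ volume := Measure.restrict_le_self.absolutelyContinuous
  have hreal : ∀ a : ι → ℝ, ∫ x in Set.Ici a, h x ∂(orthantMeasure ι) = 0 := by
    intro a
    rw [← h0 fun i => (a i).toNNReal]
    have hm : MeasurableSet {x : ι → ℝ | ∀ i, 0 ≤ x i} := by
      simpa using measurableSet_shifted (0 : ι → ℝ≥0)
    rw [orthantMeasure, Measure.restrict_restrict measurableSet_Ici,
      Measure.restrict_restrict measurableSet_Ici]
    congr 2
    ext x
    simp only [Set.mem_inter_iff, Set.mem_Ici, Pi.le_def, Set.mem_ofPred_eq, ← forall_and,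
      Real.coe_toNNReal', sup_le_iff]
    refine forall_congr' fun i => ?_
    tauto
  have huniv : ∫ x, h x ∂(orthantMeasure ι) = 0 := by
    rw [← h0 0]
    have : Set.Ici (fun i => ((0 : ι → ℝ≥0) i : ℝ)) = {x : ι → ℝ | ∀ i, 0 ≤ x i} := by
      ext x
      simp [Pi.le_def]
    rw [this, orthantMeasure, Measure.restrict_restrict_of_subset subset_rfl]
  have hgen : (inferInstance : MeasurableSpace (ι → ℝ)) = MeasurableSpace.generateFrom
      (Set.pi Set.univ '' Set.pi Set.univ fun _ : ι => Set.range (Set.Ioi : ℝ → Set ℝ)) := by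
    refine (generateFrom_eq_pi (fun i => ?_) fun i => ?_).symm
    · rw [← borel_eq_generateFrom_Ioi, ← BorelSpace.measurable_eq]
    · refine ⟨fun n => Set.Ioi (-(n : ℝ)), fun n => ⟨_, rfl⟩, Set.eq_univ_of_forall fun x => ?_⟩
      obtain ⟨n, hn⟩ := exists_nat_gt (-x)
      exact Set.mem_iUnion.2 ⟨n, by simp only [Set.mem_Ioi]; linarith⟩
  refine hint.ae_eq_zero_of_forall_setIntegral_eq_zero fun s hs hs' => ?_
  clear hs'
  induction s, hs using MeasurableSpace.induction_on_inter hgen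
    (IsPiSystem.pi fun _ => isPiSystem_Ioi) with
  | empty => simp
  | basic t ht =>
    obtain ⟨c, hc, rfl⟩ := ht
    choose a ha using fun i => hc i (Set.mem_univ i)
    have h1 : Set.pi Set.univ c = Set.pi Set.univ fun i => Set.Ioi (a i) := by
      simp only [ha]
    rw [h1, ← hreal a]
    exact setIntegral_congr_set (hac.ae_le Measure.univ_pi_Ioi_ae_eq_Ici)
  | compl t ht ih =>
    have h1 := integral_add_compl ht hint
    rwa [ih, zero_add, huniv] at h1
  | iUnion f hd hf ih =>
    rw [integral_iUnion hf hd hint.integrableOn]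
    simp [ih]

/-- Up to a nonzero constant, the shift by `a` is `e^{-|x|}` cut off to the orthant at `a`.
Orthogonality of `g` to all shifts kills the integrals of `e^{-|x|} g` over all such orthants. -/
theorem topologicalClosure_span_shift_expLp :
    (Submodule.span ℂ (Set.range fun a : ι → ℝ≥0 =>
      shift a (expLp ι))).topologicalClosure = ⊤ := by
  rw [Submodule.topologicalClosure_eq_top_iff, Submodule.eq_bot_iff]
  intro g hg
  have h1 : Integrable (fun x => expFun ι x * g x) (orthantMeasure ι) :=
    (memLp_expFun ι).integrable_mul (Lp.memLp g)
  have h2 := ae_eq_zero_of_setIntegral_Ici h1 fun a => by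
    have h3 := (Submodule.mem_orthogonal _ _).1 hg _ (Submodule.subset_span ⟨a, rfl⟩)
    have h4 : ⟪shift a (expLp ι), g⟫_ℂ = ∫ x, ((Real.exp (∑ i, (a i : ℝ)) : ℝ) : ℂ) *
        (Set.Ici (fun i => (a i : ℝ))).indicator (fun x => expFun ι x * g x) x
          ∂(orthantMeasure ι) := by
      rw [L2.inner_def]
      refine integral_congr_ae ?_
      filter_upwards [shift_expLp_coeFn a] with x hx
      rw [hx, shiftFun_expFun]
      by_cases h : x ∈ Set.Ici (fun i => (a i : ℝ))
      · rw [Set.indicator_of_mem h, Set.indicator_of_mem h, RCLike.inner_apply, expFun,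
          ← Complex.ofReal_mul, Complex.conj_ofReal]
        push_cast
        ring
      · rw [Set.indicator_of_notMem h, Set.indicator_of_notMem h, inner_zero_left, mul_zero]
    rw [h3, integral_const_mul, integral_indicator measurableSet_Ici] at h4
    exact (mul_eq_zero.1 h4.symm).resolve_left (by exact_mod_cast (Real.exp_pos _).ne')
  refine (Lp.eq_zero_iff_ae_eq_zero).2 ?_
  filter_upwards [h2] with x hx
  exact (mul_eq_zero.1 hx).resolve_left
    (by rw [expFun]; exact_mod_cast (Real.exp_pos _).ne')

theorem expLp_ne_zero : expLp ι ≠ 0 := by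
  intro h
  have h1 : expFun ι =ᵐ[orthantMeasure ι] 0 :=
    (MemLp.coeFn_toLp (memLp_expFun ι)).symm.trans ((Lp.eq_zero_iff_ae_eq_zero).1 h)
  have h2 : ∀ᵐ x ∂(orthantMeasure ι), False := by
    filter_upwards [h1] with x hx
    have h3 : expFun ι x ≠ 0 := by rw [expFun]; exact_mod_cast (Real.exp_pos _).ne'
    exact h3 hx
  have h3 : orthantMeasure ι Set.univ = 0 := by simpa [ae_iff] using h2
  rw [orthantMeasure_eq_pi, Measure.pi_univ, Finset.prod_eq_zero_iff] at h3
  simp at h3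

/-- The normalisation of `e^{-|x|}` in `L²(ℝ₊^ι)`. -/
def unitExp (ι : Type*) [Fintype ι] : L2Orthant ι := ((‖expLp ι‖⁻¹ : ℝ) : ℂ) • expLp ι

theorem inner_shift_unitExp (a b : ι → ℝ≥0) :
    ⟪shift a (unitExp ι), shift b (unitExp ι)⟫_ℂ =
      Real.exp (∑ i, ((a i : ℝ) + b i - 2 * (a i ⊔ b i : ℝ≥0))) := by
  have h0 : (‖expLp ι‖ : ℂ) ≠ 0 := by exact_mod_cast norm_ne_zero_iff.2 expLp_ne_zero
  rw [unitExp, map_smul, map_smul, inner_smul_left, inner_smul_right, inner_shift_expLp,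
    inner_self_eq_norm_sq_to_K, Complex.conj_ofReal]
  push_cast
  field_simp
  rfl

theorem topologicalClosure_span_shift_unitExp :
    (Submodule.span ℂ (Set.range fun a : ι → ℝ≥0 =>
      shift a (unitExp ι))).topologicalClosure = ⊤ := by
  rw [eq_top_iff, ← topologicalClosure_span_shift_expLp]
  refine Submodule.topologicalClosure_mono (Submodule.span_le.2 ?_)
  rintro _ ⟨a, rfl⟩
  have h0 : (‖expLp ι‖ : ℂ) ≠ 0 := by exact_mod_cast norm_ne_zero_iff.2 expLp_ne_zero
  have h1 : shift a (expLp ι) = (‖expLp ι‖ : ℂ) • shift a (unitExp ι) := by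
    rw [unitExp, map_smul, smul_smul, Complex.ofReal_inv, mul_inv_cancel₀ h0, one_smul]
  change shift a (expLp ι) ∈ _
  rw [h1]
  exact Submodule.smul_mem _ _ (Submodule.subset_span ⟨a, rfl⟩)

end ShiftModel

/-- Two families with dense span and the same Gram matrix are unitarily equivalent. -/
theorem exists_linearIsometryEquiv_of_inner_eq {X E F : Type*} [NormedAddCommGroup E]
    [InnerProductSpace ℂ E] [CompleteSpace E] [NormedAddCommGroup F] [InnerProductSpace ℂ F]
    [CompleteSpace F] (e : X → E) (g : X → F) (h : ∀ x y, ⟪e x, e y⟫_ℂ = ⟪g x, g y⟫_ℂ)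
    (he : (Submodule.span ℂ (Set.range e)).topologicalClosure = ⊤)
    (hg : (Submodule.span ℂ (Set.range g)).topologicalClosure = ⊤) :
    ∃ U : E ≃ₗᵢ[ℂ] F, ∀ x, U (e x) = g x := by
  have hinner : ∀ c : X →₀ ℂ, ‖Finsupp.linearCombination ℂ g c‖ =
      ‖Finsupp.linearCombination ℂ e c‖ := by
    intro c
    have h1 : ⟪Finsupp.linearCombination ℂ g c, Finsupp.linearCombination ℂ g c⟫_ℂ =
        ⟪Finsupp.linearCombination ℂ e c, Finsupp.linearCombination ℂ e c⟫_ℂ := by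
      simp only [Finsupp.linearCombination_apply, Finsupp.sum, sum_inner, inner_sum,
        inner_smul_left, inner_smul_right, h]
    rw [@norm_eq_sqrt_re_inner ℂ, h1, ← @norm_eq_sqrt_re_inner ℂ]
  have hee : DenseRange (Finsupp.linearCombination ℂ e) := by
    have h1 := Submodule.dense_iff_topologicalClosure_eq_top.2 he
    rw [← Finsupp.range_linearCombination] at h1
    exact h1
  have hge : DenseRange (Finsupp.linearCombination ℂ g) := by
    have h1 := Submodule.dense_iff_topologicalClosure_eq_top.2 hg
    rw [← Finsupp.range_linearCombination] at h1
    exact h1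
  refine ⟨LinearEquiv.extendOfIsometry (LinearEquiv.refl ℂ (X →₀ ℂ))
    (Finsupp.linearCombination ℂ e) (Finsupp.linearCombination ℂ g) hee hge
    hinner, fun x => ?_⟩
  have h1 := LinearEquiv.extendOfIsometry_eq (LinearEquiv.refl ℂ (X →₀ ℂ))
    (e₁ := Finsupp.linearCombination ℂ e) (e₂ := Finsupp.linearCombination ℂ g) hee hge
    hinner (Finsupp.single x 1)
  simpa using h1

/-! ### Elementary tensors and density -/

section HilbertTensor

variable {E F : Type*} [NormedAddCommGroup E] [InnerProductSpace ℂ E]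
  [NormedAddCommGroup F] [InnerProductSpace ℂ F]

/-- The elementary tensor `x ⊗ y` in the Hilbert space tensor product. -/
def hilbertTmul (x : E) (y : F) : HilbertTensor E F := ((x ⊗ₜ[ℂ] y : E ⊗[ℂ] F) : HilbertTensor E F)

theorem inner_hilbertTmul (x x' : E) (y y' : F) :
    ⟪hilbertTmul x y, hilbertTmul x' y'⟫_ℂ = ⟪x, x'⟫_ℂ * ⟪y, y'⟫_ℂ := by
  rw [hilbertTmul, hilbertTmul, UniformSpace.Completion.inner_coe, TensorProduct.inner_tmul]

theorem hilbertTensorMap_tmul (A : E →L[ℂ] E) (B : F →L[ℂ] F) (x : E) (y : F) :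
    hilbertTensorMap A B (hilbertTmul x y) = hilbertTmul (A x) (B y) := by
  rw [hilbertTensorMap, hilbertTmul, ContinuousLinearMap.completion_apply_coe]
  rfl

theorem continuous_hilbertTmul : Continuous fun p : E × F => hilbertTmul p.1 p.2 :=
  (UniformSpace.Completion.continuous_coe _).comp TensorProduct.continuous_tmul

theorem topologicalClosure_span_hilbertTmul {X : Type*} (e : X → E)
    (he : (Submodule.span ℂ (Set.range e)).topologicalClosure = ⊤) :
    (Submodule.span ℂ (Set.range fun p : X × F => hilbertTmul (e p.1) p.2)).topologicalClosure
      = ⊤ := by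
  set N := (Submodule.span ℂ
    (Set.range fun p : X × F => hilbertTmul (e p.1) p.2)).topologicalClosure with hN
  have hcl : IsClosed (N : Set (HilbertTensor E F)) := Submodule.isClosed_topologicalClosure _
  have h1 : ∀ (x : E) (y : F), hilbertTmul x y ∈ N := by
    intro x y
    let L : E →L[ℂ] HilbertTensor E F :=
      { toFun := fun x => hilbertTmul x y
        map_add' := fun a b => by
          rw [hilbertTmul, TensorProduct.add_tmul, UniformSpace.Completion.coe_add]; rfl
        map_smul' := fun c a => by
          rw [hilbertTmul, ← TensorProduct.smul_tmul', UniformSpace.Completion.coe_smul]; rfl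
        cont := continuous_hilbertTmul.comp (by fun_prop : Continuous fun x : E => (x, y)) }
    have h2 : (Submodule.span ℂ (Set.range e)).topologicalClosure ≤ N.comap L.toLinearMap := by
      refine Submodule.topologicalClosure_minimal _ (Submodule.span_le.2 ?_)
        (hcl.preimage L.continuous)
      rintro _ ⟨a, rfl⟩
      exact Submodule.le_topologicalClosure _ (Submodule.subset_span ⟨(a, y), rfl⟩)
    exact h2 (he ▸ Submodule.mem_top)
  refine Submodule.eq_top_iff'.2 fun ξ => ?_
  induction ξ using UniformSpace.Completion.induction_on with
  | hp => exact hcl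
  | ih z =>
    induction z using TensorProduct.induction_on with
    | zero => exact N.zero_mem
    | tmul x y => exact h1 x y
    | add a b ha hb =>
      rw [UniformSpace.Completion.coe_add]
      exact N.add_mem ha hb

end HilbertTensor

/-! ### Unitary equivalence with the shift model -/

namespace IsomRep

variable {ι H : Type*} [NormedAddCommGroup H] [InnerProductSpace ℂ H] [CompleteSpace H]
  [DecidableEq ι] [Fintype ι]

theorem IsUnitary.restrict {V : IsomRep ι H} (hV : V.IsUnitary) (M : V.ReducingSubspace) :
    (V.restrict M).IsUnitary := by
  intro t
  rw [mem_unitary_iff]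
  intro x
  refine Subtype.ext ?_
  change V t (((V.restrict M) t)† x : M.toSubmodule) = x
  rw [adjoint_restrict_apply]
  exact (V.mem_unitary_iff t).1 (hV t) x

theorem mem_eigenspace_sub (V : IsomRep ι H) (α : Finset ι) (x : H) :
    x ∈ (V.sub α).eigenspace ↔ x ∈ V.coordEigenspace α := by
  constructor
  · intro h i hi t
    have h1 := h ⟨i, hi⟩ (Finset.mem_univ _) t
    rwa [coord_sub] at h1
  · intro h i _ t
    rw [coord_sub]
    exact h i i.2 t

/-- The part of a doubly commuting representation which is pure in the coordinates `α` is the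
shift tensored with the restriction to the joint eigenspace. -/
theorem IsDoublyCommuting.exists_equiv_shift_tensor {V : IsomRep ι H} (hV : V.IsDoublyCommuting)
    (α : Finset ι) (hp : (V.sub α).IsStronglyPure) (E : Submodule ℂ H)
    (hE : E = V.coordEigenspace α) :
    ∃ U : HilbertTensor (L2Orthant α) E ≃ₗᵢ[ℂ] H, ∀ (a : α → ℝ≥0) (k : E),
      U (hilbertTmul (shift a (unitExp α)) k) = V.sub α a k := by
  subst hE
  have : CompleteSpace (V.coordEigenspace α) := (V.isClosed_coordEigenspace α).completeSpace_coe
  have hgram : ∀ p q : (α → ℝ≥0) × V.coordEigenspace α,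
      ⟪hilbertTmul (shift p.1 (unitExp α)) p.2, hilbertTmul (shift q.1 (unitExp α)) q.2⟫_ℂ =
        ⟪V.sub α p.1 p.2, V.sub α q.1 q.2⟫_ℂ := by
    intro p q
    rw [inner_hilbertTmul, inner_shift_unitExp]
    exact ((hV.sub α).inner_map_eigenvector ((mem_eigenspace_sub _ _ _).2 p.2.2)
      ((mem_eigenspace_sub _ _ _).2 q.2.2) _ _).symm
  have hdense : (Submodule.span ℂ (Set.range fun p : (α → ℝ≥0) × V.coordEigenspace α =>
      V.sub α p.1 p.2)).topologicalClosure = ⊤ := by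
    rw [eq_top_iff, ← (hV.sub α).topologicalClosure_span_eigenspace hp]
    refine Submodule.topologicalClosure_mono (Submodule.span_mono ?_)
    rintro _ ⟨⟨a, k⟩, rfl⟩
    exact ⟨(a, ⟨k, (mem_eigenspace_sub _ _ _).1 k.2⟩), rfl⟩
  obtain ⟨U, hU⟩ := exists_linearIsometryEquiv_of_inner_eq _ _ hgram
    (topologicalClosure_span_hilbertTmul (E := L2Orthant α) (F := V.coordEigenspace α)
      (fun a : α → ℝ≥0 => shift a (unitExp α)) topologicalClosure_span_shift_unitExp) hdense
  exact ⟨U, fun a k => hU (a, k)⟩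

theorem dense_span_shift_tmul (α : Finset ι) (K : Type*) [NormedAddCommGroup K]
    [InnerProductSpace ℂ K] :
    Dense (Submodule.span ℂ (Set.range fun p : (α → ℝ≥0) × K =>
      hilbertTmul (shift p.1 (unitExp α)) p.2) : Set (HilbertTensor (L2Orthant α) K)) := by
  rw [Submodule.dense_iff_topologicalClosure_eq_top]
  exact topologicalClosure_span_hilbertTmul (E := L2Orthant α) (F := K)
    (fun a : α → ℝ≥0 => shift a (unitExp α)) topologicalClosure_span_shift_unitExp

theorem intertwine_of_shift_tmul {K G : Type*} [NormedAddCommGroup K] [InnerProductSpace ℂ K]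
    [NormedAddCommGroup G] [InnerProductSpace ℂ G] (α : Finset ι)
    (U : HilbertTensor (L2Orthant α) K ≃ₗᵢ[ℂ] G)
    (S : HilbertTensor (L2Orthant α) K →L[ℂ] HilbertTensor (L2Orthant α) K) (T : G →L[ℂ] G)
    (h : ∀ (a : α → ℝ≥0) (k : K), U (S (hilbertTmul (shift a (unitExp α)) k)) =
      T (U (hilbertTmul (shift a (unitExp α)) k))) (ξ : HilbertTensor (L2Orthant α) K) :
    U (S ξ) = T (U ξ) := by
  let U' : HilbertTensor (L2Orthant α) K →L[ℂ] G := U.toLinearIsometry.toContinuousLinearMap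
  have hAB : U' ∘L S = T ∘L U' := by
    refine ContinuousLinearMap.ext_on (dense_span_shift_tmul α K) ?_
    rintro _ ⟨⟨a, k⟩, rfl⟩
    exact h a k
  exact DFunLike.congr_fun hAB ξ

theorem shift_add_apply {κ : Type*} [Fintype κ] (s t : κ → ℝ≥0) (f : L2Orthant κ) :
    shift (s + t) f = shift s (shift t f) := by
  have h1 : shift (s + t) f =ᵐ[orthantMeasure κ] shiftFun (s + t) f :=
    MemLp.coeFn_toLp (memLp_shiftFun (s + t) f)
  have h2 : shift s (shift t f) =ᵐ[orthantMeasure κ] shiftFun s (shiftFun t f) :=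
    (MemLp.coeFn_toLp (memLp_shiftFun s (shift t f))).trans
      (shiftFun_congr_ae s (MemLp.coeFn_toLp (memLp_shiftFun t f)))
  refine Lp.ext (h1.trans (EventuallyEq.trans (Eventually.of_forall fun x => ?_) h2.symm))
  simp only [shiftFun, Set.indicator_apply, Set.mem_ofPred_eq]
  have h3 : (∀ i, 0 ≤ x i - (s + t) i) ↔ (∀ i, 0 ≤ x i - s i) ∧ ∀ i, 0 ≤ x i - s i - t i := by
    rw [← forall_and]
    refine forall_congr' fun i => ?_
    have := (t i).coe_nonneg
    rw [Pi.add_apply, NNReal.coe_add]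
    constructor
    · intro h; constructor <;> linarith
    · rintro ⟨_, h⟩; linarith
  have h4 : (fun i => x i - ((s + t) i : ℝ)) = fun i => x i - s i - t i := by
    funext i
    rw [Pi.add_apply, NNReal.coe_add]
    ring
  by_cases ha : ∀ i, 0 ≤ x i - s i
  · by_cases hb : ∀ i, 0 ≤ x i - s i - t i
    · simp only [if_pos (h3.2 ⟨ha, hb⟩), if_pos ha, if_pos hb, h4]
    · rw [if_neg (fun h => hb (h3.1 h).2), if_pos ha, if_neg hb]
  · rw [if_neg (fun h => ha (h3.1 h).1), if_neg ha]

/-- `W` is the action of the coordinates outside `α` on the joint eigenspace of those in `α`. Both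
intertwining relations need checking only on the total vectors `Sₐ f ⊗ k ↦ Vₐ k`. -/
theorem equivShiftTensor_coordEigenspace {V : IsomRep ι H} (hV : V.IsDoublyCommuting)
    (M : V.ReducingSubspace) (α : Finset ι) (hp : ((V.restrict M).sub α).IsStronglyPure) :
    V.EquivShiftTensor M α (((V.restrict M).sub αᶜ).restrict
      ((hV.restrict M).coordEigenspaceReducing α αᶜ disjoint_compl_right)) := by
  obtain ⟨U, hU⟩ := (hV.restrict M).exists_equiv_shift_tensor α hp
    ((hV.restrict M).coordEigenspaceReducing α αᶜ disjoint_compl_right).toSubmodule rfl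
  refine ⟨U, fun t => intertwine_of_shift_tmul α U _ _ fun a k => ?_,
    fun s => intertwine_of_shift_tmul α U _ _ fun a k => ?_⟩
  · rw [hilbertTensorMap_tmul, hU, ← map_add_apply]
    change U (hilbertTmul (shift t (shift a (unitExp α))) k) = _
    rw [← shift_add_apply, hU]
  · rw [hilbertTensorMap_tmul, hU]
    exact (hU a _).trans ((V.restrict M).map_comm_apply _ _ _)

end IsomRep

/-! ### Products and adjoints of operators `A ⊗ B` -/

section HilbertTensor

variable {E F : Type*} [NormedAddCommGroup E] [InnerProductSpace ℂ E]
  [NormedAddCommGroup F] [InnerProductSpace ℂ F]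

theorem hilbertTensorMap_mul_apply (A A' : E →L[ℂ] E) (B B' : F →L[ℂ] F) (ξ : HilbertTensor E F) :
    hilbertTensorMap A B (hilbertTensorMap A' B' ξ) = hilbertTensorMap (A * A') (B * B') ξ := by
  induction ξ using UniformSpace.Completion.induction_on with
  | hp => exact isClosed_eq (by fun_prop) (by fun_prop)
  | ih z =>
    simp only [hilbertTensorMap, ContinuousLinearMap.completion_apply_coe, TensorProduct.mapL_mul]
    rfl

theorem hilbertTensorMap_zero_right (A : E →L[ℂ] E) (ξ : HilbertTensor E F) :
    hilbertTensorMap A 0 ξ = 0 := by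
  induction ξ using UniformSpace.Completion.induction_on with
  | hp => exact isClosed_eq (by fun_prop) continuous_const
  | ih z =>
    rw [hilbertTensorMap, ContinuousLinearMap.completion_apply_coe, TensorProduct.mapL_zero_right]
    exact UniformSpace.Completion.coe_zero

theorem inner_hilbertTensorMap_left [CompleteSpace E] [CompleteSpace F] (A : E →L[ℂ] E)
    (B : F →L[ℂ] F) (ξ η : HilbertTensor E F) :
    ⟪hilbertTensorMap A B ξ, η⟫_ℂ = ⟪ξ, hilbertTensorMap A† B† η⟫_ℂ := by
  induction ξ, η using UniformSpace.Completion.induction_on₂ with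
  | hp => exact isClosed_eq (by fun_prop) (by fun_prop)
  | ih z w =>
    simp only [hilbertTensorMap, ContinuousLinearMap.completion_apply_coe,
      UniformSpace.Completion.inner_coe]
    induction z using TensorProduct.induction_on with
    | zero => simp only [map_zero, inner_zero_left]
    | add a b ha hb => simp only [map_add, inner_add_left, ha, hb]
    | tmul x y =>
      induction w using TensorProduct.induction_on with
      | zero => simp only [map_zero, inner_zero_right]
      | add a b ha hb => simp only [map_add, inner_add_right, ha, hb]
      | tmul x' y' =>
        simp only [TensorProduct.mapL_tmul, TensorProduct.inner_tmul,
          ContinuousLinearMap.adjoint_inner_right]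

theorem eq_zero_of_hilbertTensorMap_one_eq_zero {B : F →L[ℂ] F} {x : E} (hx : x ≠ 0)
    (h : ∀ ξ : HilbertTensor E F, hilbertTensorMap 1 B ξ = 0) : B = 0 := by
  ext y
  have h1 := h (hilbertTmul x y)
  rw [hilbertTensorMap_tmul, ← inner_self_eq_zero (𝕜 := ℂ), inner_hilbertTmul, mul_eq_zero,
    inner_self_eq_zero, inner_self_eq_zero] at h1
  exact h1.resolve_left hx

end HilbertTensor

/-! ### Scalar normal operators and extension of characters -/

section Scalar

variable {K : Type*} [NormedAddCommGroup K] [InnerProductSpace ℂ K] [CompleteSpace K]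

/-- A normal operator whose continuous functional calculus has no zero divisors is scalar. -/
theorem exists_eq_smul_one_of_cfc_no_zero_divisors [Nontrivial K] (T : K →L[ℂ] K)
    [IsStarNormal T]
    (h : ∀ f g : ℂ → ℂ, cfc f T * cfc g T = 0 → cfc f T = 0 ∨ cfc g T = 0) :
    ∃ c : ℂ, T = c • 1 := by
  obtain ⟨c, hc⟩ : (spectrum ℂ T).Nonempty := spectrum.nonempty T
  have hne : ∀ f : ℂ → ℂ, Continuous f → ∀ z ∈ spectrum ℂ T, f z ≠ 0 → cfc f T ≠ 0 := by
    intro f hf z hz hfz h0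
    have h1 := cfc_map_spectrum f T (hf := hf.continuousOn)
    rw [h0, spectrum.zero_eq] at h1
    exact hfz (h1.symm ▸ Set.mem_image_of_mem f hz : f z ∈ ({0} : Set ℂ))
  have hsub : ∀ z ∈ spectrum ℂ T, z = c := by
    intro z hz
    by_contra hzc
    let r : ℝ := dist z c / 2
    have hr : 0 < r := half_pos (dist_pos.2 hzc)
    -- Tent functions around two distinct spectral points, with radius half their distance: the
    -- product vanishes but neither factor does on the spectrum.
    let b : ℂ → ℂ → ℂ := fun p w => ((max 0 (r - dist w p) : ℝ) : ℂ)
    have hb : ∀ p, Continuous (b p) := fun p => by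
      simp only [b]
      exact Complex.continuous_ofReal.comp (by fun_prop)
    have hbp : ∀ p, b p p ≠ 0 := fun p => by
      simp only [b, dist_self, sub_zero, max_eq_right hr.le]
      exact_mod_cast hr.ne'
    have hmul : cfc (b z) T * cfc (b c) T = 0 := by
      rw [← cfc_mul (b z) (b c) T (hb z).continuousOn (hb c).continuousOn,
        ← cfc_zero ℂ T]
      congr 1
      funext w
      change b z w * b c w = 0
      rcases le_total r (dist w z) with h1 | h1
      · simp [b, max_eq_left (sub_nonpos.2 h1)]
      · have h2 : r ≤ dist w c := by
          have h3 := dist_triangle_left z c w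
          have h4 : dist z c = 2 * r := by simp only [r]; ring
          linarith
        simp [b, max_eq_left (sub_nonpos.2 h2)]
    rcases h _ _ hmul with h1 | h1
    · exact hne _ (hb z) z hz (hbp z) h1
    · exact hne _ (hb c) c hc (hbp c) h1
  refine ⟨c, ?_⟩
  calc T = cfc (id : ℂ → ℂ) T := (cfc_id ℂ T).symm
    _ = cfc (fun _ => c) T := cfc_congr fun z hz => hsub z hz
    _ = c • 1 := by rw [cfc_const c T, Algebra.algebraMap_eq_smul_one]

end Scalar

/-- A continuous circle-valued character of `ℝ₊^κ` extends to `ℝ^κ`. -/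
theorem exists_addChar_extending {κ : Type*} (γ : (κ → ℝ≥0) → Circle)
    (hadd : ∀ s t, γ (s + t) = γ s * γ t) (hc : Continuous γ) :
    ∃ χ : AddChar (κ → ℝ) Circle, Continuous χ ∧ ∀ s, χ (fun j => (s j : ℝ)) = γ s := by
  have h0 : γ 0 = 1 := by
    have h := hadd 0 0
    rw [add_zero] at h
    exact left_eq_mul.1 h
  -- The extension is `γ(x⁺) / γ(x⁻)`, with `p` the positive part; `hp` is additivity of `x⁺ - x⁻`
  -- with the subtractions cleared.
  let p : (κ → ℝ) → κ → ℝ≥0 := fun x j => (x j).toNNReal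
  have hp : ∀ x y, p (x + y) + p (-x) + p (-y) = p (-(x + y)) + p x + p y := by
    intro x y
    funext j
    refine NNReal.coe_injective ?_
    have hpm : ∀ r : ℝ, (r.toNNReal : ℝ) - ((-r).toNNReal : ℝ) = r := by
      intro r
      rcases le_total 0 r with h | h
      · simp [Real.coe_toNNReal r h, Real.toNNReal_of_nonpos (neg_nonpos.2 h)]
      · simp [Real.coe_toNNReal (-r) (neg_nonneg.2 h), Real.toNNReal_of_nonpos h]
    have h1 := hpm (x j)
    have h2 := hpm (y j)
    have h3 := hpm (x j + y j)
    simp only [p, Pi.add_apply, Pi.neg_apply, NNReal.coe_add]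
    linarith
  have hpc : Continuous p := by
    refine continuous_pi fun j => continuous_real_toNNReal.comp (continuous_apply j)
  refine ⟨{ toFun := fun x => γ (p x) / γ (p (-x)), map_zero_eq_one' := ?_,
            map_add_eq_mul' := ?_ }, ?_, ?_⟩
  · rw [neg_zero, div_self']
  · intro x y
    have h := congrArg γ (hp x y)
    rw [hadd, hadd, hadd, hadd] at h
    rw [div_mul_div_comm, div_eq_div_iff_mul_eq_mul, ← mul_assoc, h]
    rw [mul_assoc, mul_comm]
  · exact (hc.comp hpc).div' (hc.comp (hpc.comp continuous_neg))
  · intro s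
    have h1 : p (fun j => (s j : ℝ)) = s := by
      funext j; simp [p]
    have h2 : p (-(fun j => (s j : ℝ))) = 0 := by
      funext j
      simp [p]
    change γ (p fun j => (s j : ℝ)) / γ (p (-(fun j => (s j : ℝ)))) = γ s
    rw [h1, h2, h0, div_one]

/-! ### Irreducible representations -/

namespace IsomRep

section Irreducible

variable {ι G K : Type*} [DecidableEq ι] [Fintype ι]
  [NormedAddCommGroup G] [InnerProductSpace ℂ G] [CompleteSpace G]
  [NormedAddCommGroup K] [InnerProductSpace ℂ K] [CompleteSpace K]

theorem map_eq_sub_mul_sub (V : IsomRep ι G) (α : Finset ι) (t : ι → ℝ≥0) (x : G) :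
    V t x = V.sub α (fun i => t i) (V.sub αᶜ (fun i => t i) x) := by
  have h : t = extendZero α (fun i => t i) + extendZero αᶜ (fun i => t i) := by
    funext i
    by_cases hi : i ∈ α <;> simp [extendZero, hi]
  conv_lhs => rw [h, map_add_apply]
  rfl

theorem IsIrreducible.restrict {V : IsomRep ι G} (hV : V.IsIrreducible) (M : V.ReducingSubspace)
    (hM : M.toSubmodule ≠ ⊥) : (V.restrict M).IsIrreducible := by
  refine ⟨Submodule.nontrivial_iff_ne_bot.2 hM, fun N => ?_⟩
  have hMtop : M.toSubmodule = ⊤ := (hV.2 M).resolve_left hM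
  let N' : V.ReducingSubspace :=
    { toSubmodule := N.toSubmodule.map M.toSubmodule.subtype
      isClosed' := by
        rw [Submodule.map_coe]
        exact M.isClosed'.isClosedEmbedding_subtypeVal.isClosedMap _ N.isClosed'
      map_mem' := by
        rintro t _ ⟨x, hx, rfl⟩
        exact ⟨(V.restrict M) t x, N.map_mem' t x hx, rfl⟩
      adjoint_mem' := by
        rintro t _ ⟨x, hx, rfl⟩
        exact ⟨((V.restrict M) t)† x, N.adjoint_mem' t x hx, V.adjoint_restrict_apply M t x⟩ }
  rcases hV.2 N' with h | h
  · left
    exact Submodule.map_injective_of_injective M.toSubmodule.injective_subtype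
      (h.trans (Submodule.map_bot _).symm)
  · right
    refine Submodule.eq_top_iff'.2 fun x => ?_
    have hx : (x : G) ∈ N'.toSubmodule := h ▸ Submodule.mem_top
    obtain ⟨y, hy, hyx⟩ := hx
    rwa [← Subtype.ext hyx]

/-- The operator `1 ⊗ B`, transported by a unitary. -/
def transport {α : Finset ι} (U : HilbertTensor (L2Orthant α) K ≃ₗᵢ[ℂ] G) (B : K →L[ℂ] K)
    (x : G) : G :=
  U (hilbertTensorMap 1 B (U.symm x))

theorem inner_transport_left {α : Finset ι} (U : HilbertTensor (L2Orthant α) K ≃ₗᵢ[ℂ] G)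
    (B : K →L[ℂ] K) (x y : G) : ⟪transport U B x, y⟫_ℂ = ⟪x, transport U B† y⟫_ℂ := by
  have h1 : (1 : L2Orthant α →L[ℂ] L2Orthant α)† = 1 := ContinuousLinearMap.adjoint_id
  rw [transport, transport, ← LinearIsometryEquiv.inner_map_map U.symm,
    LinearIsometryEquiv.symm_apply_apply, inner_hilbertTensorMap_left, h1,
    ← LinearIsometryEquiv.inner_map_map U, LinearIsometryEquiv.apply_symm_apply]

variable (V : IsomRep ι G) {α : Finset ι} (W : IsomRep (αᶜ : Finset ι) K)
  (U : HilbertTensor (L2Orthant α) K ≃ₗᵢ[ℂ] G)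

theorem transport_map
    (hU₁ : ∀ (t : α → ℝ≥0) (ξ : HilbertTensor (L2Orthant α) K),
      U (hilbertTensorMap (shift t).toContinuousLinearMap 1 ξ) = V.sub α t (U ξ))
    (hU₂ : ∀ (s : (αᶜ : Finset ι) → ℝ≥0) (ξ : HilbertTensor (L2Orthant α) K),
      U (hilbertTensorMap 1 (W s) ξ) = V.sub αᶜ s (U ξ))
    (B : K →L[ℂ] K) (hB : ∀ s, B * W s = W s * B) (t : ι → ℝ≥0) (x : G) :
    transport U B (V t x) = V t (transport U B x) := by
  obtain ⟨ξ, rfl⟩ := U.surjective x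
  rw [V.map_eq_sub_mul_sub α, V.map_eq_sub_mul_sub α, transport, transport,
    LinearIsometryEquiv.symm_apply_apply, ← hU₂, ← hU₁, ← hU₂, ← hU₁,
    LinearIsometryEquiv.symm_apply_apply]
  simp only [hilbertTensorMap_mul_apply, mul_one, one_mul, hB]

theorem IsUnitary.adjoint_commute {W : IsomRep (αᶜ : Finset ι) K} (hW : W.IsUnitary)
    (B : K →L[ℂ] K) (hB : ∀ s, B * W s = W s * B) (s : (αᶜ : Finset ι) → ℝ≥0) :
    B† * W s = W s * B† := by
  have h1 : (W s)† * W s = 1 := (Unitary.mem_iff.1 (hW s)).1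
  have h2 : W s * (W s)† = 1 := (Unitary.mem_iff.1 (hW s)).2
  have h3 : (W s)† * B = B * (W s)† := by
    calc (W s)† * B = (W s)† * (B * W s) * (W s)† := by rw [mul_assoc, mul_assoc, h2, mul_one]
      _ = ((W s)† * W s) * B * (W s)† := by rw [hB]; simp only [mul_assoc]
      _ = B * (W s)† := by rw [h1, one_mul]
  have h4 := congrArg star h3
  rw [star_mul, star_mul] at h4
  simpa only [ContinuousLinearMap.star_eq_adjoint, ContinuousLinearMap.adjoint_adjoint] using h4

variable {V W}

/-- The kernel of the transported `1 ⊗ B` is reducing, because `B` and, by unitarity of `W`, also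
`B†` commute with `W`. It is either everything, so `B = 0`, or zero; and it contains the range of `1
⊗ B'`. -/
theorem IsIrreducible.commutant_no_zero_divisors (hV : V.IsIrreducible) (hW : W.IsUnitary)
    (hU₁ : ∀ (t : α → ℝ≥0) (ξ : HilbertTensor (L2Orthant α) K),
      U (hilbertTensorMap (shift t).toContinuousLinearMap 1 ξ) = V.sub α t (U ξ))
    (hU₂ : ∀ (s : (αᶜ : Finset ι) → ℝ≥0) (ξ : HilbertTensor (L2Orthant α) K),
      U (hilbertTensorMap 1 (W s) ξ) = V.sub αᶜ s (U ξ))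
    (B B' : K →L[ℂ] K) (hB : ∀ s, B * W s = W s * B) (h : B * B' = 0) : B = 0 ∨ B' = 0 := by
  have hexp : unitExp α ≠ 0 := by
    intro h0
    have h1 := inner_shift_unitExp (ι := α) 0 0
    rw [h0, map_zero, inner_zero_left] at h1
    exact (Real.exp_pos _).ne (by exact_mod_cast h1)
  let C : G →L[ℂ] G := U.toLinearIsometry.toContinuousLinearMap ∘L
    hilbertTensorMap 1 B ∘L U.symm.toLinearIsometry.toContinuousLinearMap
  have hC : ∀ x, C x = transport U B x := fun x => rfl
  let N : V.ReducingSubspace :=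
    { toSubmodule := LinearMap.ker C.toLinearMap
      isClosed' := C.isClosed_ker
      map_mem' := fun t x hx => by
        change C (V t x) = 0
        rw [hC, transport_map V W U hU₁ hU₂ B hB, ← hC]
        exact (congrArg _ hx).trans (map_zero _)
      adjoint_mem' := fun t x hx => by
        change C ((V t)† x) = 0
        have h1 : C x = 0 := hx
        refine ext_inner_right ℂ fun y => ?_
        rw [hC, inner_transport_left, ContinuousLinearMap.adjoint_inner_left,
          ← transport_map V W U hU₁ hU₂ B† (hW.adjoint_commute B hB), ← inner_transport_left,
          ← hC, h1, inner_zero_left, inner_zero_left] }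
  rcases hV.2 N with hN | hN
  · right
    refine eq_zero_of_hilbertTensorMap_one_eq_zero hexp fun ξ => ?_
    have h1 : U (hilbertTensorMap 1 B' ξ) ∈ N.toSubmodule := by
      change transport U B _ = 0
      rw [transport, LinearIsometryEquiv.symm_apply_apply, hilbertTensorMap_mul_apply, h]
      rw [hilbertTensorMap_zero_right, map_zero]
    rw [hN, Submodule.mem_bot] at h1
    exact (LinearIsometryEquiv.map_eq_zero_iff U).1 h1
  · left
    refine eq_zero_of_hilbertTensorMap_one_eq_zero hexp fun ξ => ?_
    have h1 : U ξ ∈ N.toSubmodule := hN ▸ Submodule.mem_top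
    have h2 : transport U B (U ξ) = 0 := h1
    rw [transport, LinearIsometryEquiv.symm_apply_apply] at h2
    exact (LinearIsometryEquiv.map_eq_zero_iff U).1 h2

theorem IsIrreducible.finrank_eq_one_and_exists_addChar (hV : V.IsIrreducible)
    (hW : W.IsUnitary)
    (hU₁ : ∀ (t : α → ℝ≥0) (ξ : HilbertTensor (L2Orthant α) K),
      U (hilbertTensorMap (shift t).toContinuousLinearMap 1 ξ) = V.sub α t (U ξ))
    (hU₂ : ∀ (s : (αᶜ : Finset ι) → ℝ≥0) (ξ : HilbertTensor (L2Orthant α) K),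
      U (hilbertTensorMap 1 (W s) ξ) = V.sub αᶜ s (U ξ)) :
    Module.finrank ℂ K = 1 ∧ ∃ χ : AddChar ((αᶜ : Finset ι) → ℝ) Circle, Continuous χ ∧
      ∀ (s : (αᶜ : Finset ι) → ℝ≥0) (k : K), W s k = (χ (fun j => (s j : ℝ)) : ℂ) • k := by
  have hnzd := hV.commutant_no_zero_divisors U hW hU₁ hU₂
  have hKn : Nontrivial K := by
    by_contra hcon
    rw [not_nontrivial_iff_subsingleton] at hcon
    have : Nontrivial G := hV.1
    obtain ⟨x, hx⟩ := exists_ne (0 : G)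
    refine hx ?_
    have h1 : U.symm x = 0 := by
      generalize U.symm x = ξ
      induction ξ using UniformSpace.Completion.induction_on with
      | hp => exact isClosed_eq continuous_id continuous_const
      | ih z => rw [Subsingleton.elim z 0, UniformSpace.Completion.coe_zero]
    exact (LinearIsometryEquiv.map_eq_zero_iff U.symm).1 h1
  have hcomm : ∀ s t, W s * W t = W t * W s := fun s t => by
    rw [← W.map_add', ← W.map_add', add_comm]
  have hscal : ∀ s, ∃ c : ℂ, W s = c • 1 := by
    intro s
    have hn : IsStarNormal (W s) := ⟨by
      rw [Commute, SemiconjBy, (Unitary.mem_iff.1 (hW s)).1, (Unitary.mem_iff.1 (hW s)).2]⟩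
    refine exists_eq_smul_one_of_cfc_no_zero_divisors (W s) fun f g hfg => ?_
    refine hnzd _ _ (fun t => ?_) hfg
    refine Commute.cfc (hcomm s t) ?_ f
    exact hW.adjoint_commute (W s) (fun t => hcomm s t) t
  choose c hc using hscal
  have hcomm' : ∀ (B : K →L[ℂ] K) s, B * W s = W s * B := by
    intro B s
    rw [hc s, mul_smul_comm, smul_mul_assoc, mul_one, one_mul]
  obtain ⟨k, hk⟩ := exists_ne (0 : K)
  have hWk : ∀ s x, W s x = c s • x := fun s x => by rw [hc s]; rfl
  constructor
  · rw [finrank_eq_one_iff_of_nonzero k hk]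
    -- Once `W` is scalar its commutant is everything, so the absence of zero divisors applies to `P
    -- * (1 - P) = 0`.
    let P := (ℂ ∙ k).starProjection
    have hP : P * (1 - P) = 0 := by
      rw [mul_sub, mul_one, sub_eq_zero]
      exact (Submodule.isIdempotentElem_starProjection _).eq.symm
    rcases hnzd P (1 - P) (hcomm' P) hP with h | h
    · refine (hk ?_).elim
      rw [← Submodule.starProjection_eq_self_iff.2 (Submodule.mem_span_singleton_self (R := ℂ) k)]
      exact DFunLike.congr_fun h k
    · refine Submodule.eq_top_iff'.2 fun x => ?_
      rw [← Submodule.starProjection_eq_self_iff]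
      exact (DFunLike.congr_fun (sub_eq_zero.1 h) x).symm
  · have hnorm : ∀ s, ‖c s‖ = 1 := by
      intro s
      have h1 := W.isometry' s k
      rw [hWk, norm_smul] at h1
      exact (mul_eq_right₀ (norm_ne_zero_iff.2 hk)).1 h1
    let γ : ((αᶜ : Finset ι) → ℝ≥0) → Circle := fun s => ⟨c s, mem_sphere_zero_iff_norm.2 (hnorm s)⟩
    obtain ⟨χ, hχ, hχγ⟩ := exists_addChar_extending γ (fun s t => by
      refine Subtype.ext ?_
      have h1 := W.map_add_apply s t k
      rw [hWk, hWk, hWk, smul_smul] at h1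
      exact smul_left_injective ℂ hk h1) (by
      refine Continuous.subtype_mk ?_ _
      -- A matrix coefficient recovers the scalar and makes it continuous in `s`.
      have h1 : ∀ s, c s = ⟪k, W s k⟫_ℂ / ⟪k, k⟫_ℂ := by
        intro s
        rw [hWk, inner_smul_right, mul_div_cancel_right₀ _ (inner_self_ne_zero.2 hk)]
      exact ((continuous_const.inner (W.continuous' k)).div_const _).congr fun s => (h1 s).symm)
    refine ⟨χ, hχ, fun s x => ?_⟩
    rw [hχγ, hWk]

end Irreducible

end IsomRep

end

/-! ### Assembly of the three parts -/

theorem mainTheorem3 {d : ℕ} {H : Type u} [NormedAddCommGroup H] [InnerProductSpace ℂ H]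
    [CompleteSpace H] (V : IsomRep (Fin d) H) (hV : V.IsDoublyCommuting) :
    (∃! M : Finset (Fin d) → V.ReducingSubspace, V.IsWold M) ∧
    ∀ M : Finset (Fin d) → V.ReducingSubspace, V.IsWold M →
      (TopologicalSpace.SeparableSpace H → ∀ α : Finset (Fin d),
        ∃ (K : Type u) (_ : NormedAddCommGroup K) (_ : InnerProductSpace ℂ K)
          (_ : CompleteSpace K) (W : IsomRep (αᶜ : Finset (Fin d)) K),
          TopologicalSpace.SeparableSpace K ∧ W.IsUnitary ∧ V.EquivShiftTensor (M α) α W) ∧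
      (V.IsIrreducible →
        (∃! α : Finset (Fin d), (M α).toSubmodule ≠ ⊥) ∧
        ∀ α : Finset (Fin d), (M α).toSubmodule ≠ ⊥ →
          ∀ (K : Type u) [NormedAddCommGroup K] [InnerProductSpace ℂ K] [CompleteSpace K]
            (W : IsomRep (αᶜ : Finset (Fin d)) K), W.IsUnitary → V.EquivShiftTensor (M α) α W →
            Module.finrank ℂ K = 1 ∧
            ∃ χ : AddChar ((αᶜ : Finset (Fin d)) → ℝ) Circle, Continuous χ ∧
              ∀ (s : (αᶜ : Finset (Fin d)) → ℝ≥0) (k : K),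
                W s k = (χ (fun j => (s j : ℝ)) : ℂ) • k) := by
  refine ⟨⟨V.woldSubspace hV, IsomRep.isWold_woldSubspace hV, fun M hM => hM.eq_woldSubspace hV⟩,
    fun M hM => ⟨fun hsep α => ?_, fun hirr => ⟨?_, ?_⟩⟩⟩
  · let E := (hV.restrict (M α)).coordEigenspaceReducing α αᶜ disjoint_compl_right
    have : SecondCountableTopology H := UniformSpace.secondCountable_of_separable H
    exact ⟨E.toSubmodule, inferInstance, inferInstance, inferInstance,
      ((V.restrict (M α)).sub αᶜ).restrict E, inferInstance, (hM.isUnitary α).restrict E,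
      IsomRep.equivShiftTensor_coordEigenspace hV (M α) α (hM.isStronglyPure α)⟩
  · have : Nontrivial H := hirr.1
    obtain ⟨α, hα⟩ : ∃ α, (M α).toSubmodule ≠ ⊥ := by
      by_contra! hcon
      have h := hM.topologicalClosure_iSup
      simp only [hcon, iSup_bot] at h
      rw [IsClosed.submodule_topologicalClosure_eq (by simp)] at h
      exact bot_ne_top h
    refine ⟨α, hα, fun β hβ => ?_⟩
    by_contra hne
    have hαt := (hirr.2 (M α)).resolve_left hα
    have hβt := (hirr.2 (M β)).resolve_left hβ
    obtain ⟨x, hx⟩ := exists_ne (0 : H)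
    -- Two nonzero summands would both be the whole space, yet orthogonal, so `x` would be
    -- orthogonal to itself.
    have h := hM.isHilbertSum.OrthogonalFamily hne ⟨x, hβt ▸ Submodule.mem_top⟩
      ⟨x, hαt ▸ Submodule.mem_top⟩
    exact hx (inner_self_eq_zero.1 h)
  · rintro α hα K _ _ _ W hW ⟨U, hU₁, hU₂⟩
    exact (hirr.restrict (M α) hα).finrank_eq_one_and_exists_addChar U hW hU₁ hU₂
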